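/- Conventions. Inner products are linear in the first argument; $[E,E]$ denotes the bounded operators on a Hilbert space $E$; $\Im T=(T-T^*)/(2i)$. Let $V$ be a $[E,E]$-valued function meromorphic in $\mathbb C\setminus\mathbb R$, let $Z_V\subset\mathbb C\setminus\mathbb R$ be its domain of holomorphy, and put $$N_V(z,\zeta)=\frac{V(\zeta)-V(z)^*}{\zeta-\bar z}\quad(z,\zeta\in Z_V,\ \zeta\ne\bar z),\qquad N_V(z,\bar z)=V'(\bar z).$$ * $V\in N_\kappa$ means: $V(\bar z)=V(z)^*$ for $z\in Z_V$; for all $z_0,\dots,z_n\in Z_V$ and $h_0,\dots,h_n\in E$ the Hermitian form $\sum_{j,k=0}^n\big(N_V(z_j,z_k)h_j,h_k\big)\xi_j\bar\xi_k$ on $\mathbb C^{n+1}$ has at most $\kappa$ negative squares; and for at least one such choice it has exactly $\kappa$ negative squares. * For $\dim E<\infty$, $V\in N_\kappa(R)$ means: $V\in N_\kappa$; $\lim_{y\uparrow\infty}y^{-1}(V(iy)f,f)=0$ for all $f\in E$; $\bigcap_{\zeta\in Z_V}\ker N_V(\zeta,z)=\{0\}$ for all $z\in Z_V$; and $\lim_{y\uparrow\infty}V(iy)f=0$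 for all $f\in\mathcal B$, where $\mathcal B$ is the set of all $f\in E$ for which $y\,(\Im V(iy)f,f)$ has a finite limit as $y\uparrow\infty$. * $V\in N^1_\kappa(R)$ means: $V\in N_\kappa(R)$ and $\mathcal B=E$. **Theorem.** (i) Let $\mathcal H_0$ and $\mathfrak N$ be complex Hilbert spaces with $\dim\mathfrak N=\kappa<\infty$. Let $A_0$ be a (possibly unbounded) self-adjoint operator in $\mathcal H_0$, let $B$ be a bounded operator from $\mathcal H_0$ into $\mathfrak N$, and let $D$ be a self-adjoint operator in $\mathfrak N$. Then the function $$V(z)=-\big(D+B(A_0-z)^{-1}B^*-z\big)^{-1},\qquad z\in\mathbb C\setminus\mathbb R$$ (meromorphic in $\mathbb C\setminus\mathbb R$), belongs to the class $N^1_\kappa(R)$ in the space $\mathfrak N$. (ii) Let $d\in\mathbb R$, $\gamma\in\mathbb C$, $\gamma\neq0$, and let $\rho(t)=\frac2\pi\sqrt{1-t^2}$ be the semicircle weight on $[-1,1]$. The scalar function $$V(z)=-\Big(d+|\gamma|^2\int_{-1}^1\frac{\rho(t)}{t-z}\,dt-z\Big)^{-1},\qquad z\in\mathbb C\setminus\mathbb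 R,$$ belongs to $N^1_1(R)$ (with $E=\mathbb C$), and $$V(z)=\frac{1}{(1+2|\gamma|^2)z-2|\gamma|^2\sqrt{z^2-1}-d},$$ where $\sqrt{z^2-1}$ is the square root whose imaginary part has the same sign as $\Im z$. -/

import Mathlib

open Filter Topology

noncomputable section

namespace KreinLanger

section Resolvent

variable {H : Type*} [NormedAddCommGroup H] [InnerProductSpace ℂ H]

/-- `R` is the everywhere defined bounded inverse `(A - z)⁻¹` of the (possibly unbounded)
operator `A - z`. -/
def IsResolventAt (A : H →ₗ.[ℂ] H) (z : ℂ) (R : H →L[ℂ] H) : Prop :=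
  (∀ x : A.domain, R (A x - z • (x : H)) = x) ∧
    ∀ y : H, ∃ x : A.domain, (x : H) = R y ∧ A x - z • (x : H) = y

/-- The bounded inverse is unique. -/
theorem IsResolventAt.unique {A : H →ₗ.[ℂ] H} {z : ℂ} {R S : H →L[ℂ] H}
    (hR : IsResolventAt A z R) (hS : IsResolventAt A z S) : R = S := by
  ext y
  obtain ⟨x, hx, hxy⟩ := hR.2 y
  rw [← hx, ← hS.1 x, hxy]

open Classical in
/-- The resolvent `(A - z)⁻¹` (and `0` if `z` is not in the resolvent set). For self-adjoint `A`
and nonreal `z` it is the genuine resolvent, see `isResolventAt_resolvent`. -/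
def resolvent (A : H →ₗ.[ℂ] H) (z : ℂ) : H →L[ℂ] H :=
  if h : ∃ R : H →L[ℂ] H, IsResolventAt A z R then h.choose else 0

theorem norm_le_of_isSelfAdjoint [CompleteSpace H] {A : H →ₗ.[ℂ] H} (hA : IsSelfAdjoint A)
    (z : ℂ) (x : A.domain) : |z.im| * ‖(x : H)‖ ≤ ‖A x - z • (x : H)‖ := by
  have hf : A.IsFormalAdjoint A := by
    have h := LinearPMap.adjoint_isFormalAdjoint hA.dense_domain
    rwa [LinearPMap.isSelfAdjoint_def.mp hA] at h
  have h1 : (inner ℂ (x : H) (A x)).im = 0 := by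
    have h2 : (starRingEnd ℂ) (inner ℂ (x : H) (A x)) = inner ℂ (x : H) (A x) := by
      rw [inner_conj_symm]; exact hf x x
    exact Complex.conj_eq_iff_im.mp h2
  have h3 : (inner ℂ (x : H) (A x - z • (x : H))).im = -(z.im * ‖(x : H)‖ ^ 2) := by
    rw [inner_sub_right, inner_smul_right, inner_self_eq_norm_sq_to_K, Complex.sub_im, h1]
    have : (((‖(x : H)‖ : ℝ) : ℂ)) ^ 2 = ((‖(x : H)‖ ^ 2 : ℝ) : ℂ) := by push_cast; ring
    simp only [Complex.coe_algebraMap, this, Complex.im_mul_ofReal, zero_sub]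
  have h4 : |z.im| * ‖(x : H)‖ ^ 2 ≤ ‖(x : H)‖ * ‖A x - z • (x : H)‖ := by
    calc |z.im| * ‖(x : H)‖ ^ 2 = |(inner ℂ (x : H) (A x - z • (x : H))).im| := by
          rw [h3, abs_neg, abs_mul, abs_of_nonneg (sq_nonneg ‖(x : H)‖)]
      _ ≤ ‖inner ℂ (x : H) (A x - z • (x : H))‖ := Complex.abs_im_le_norm _
      _ ≤ _ := norm_inner_le_norm _ _
  rcases (norm_nonneg (x : H)).eq_or_lt with h0 | h0
  · rw [← h0, mul_zero]; exact norm_nonneg _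
  · nlinarith

/-- The nonreal numbers belong to the resolvent set of a self-adjoint operator. -/
theorem isResolventAt_resolvent [CompleteSpace H] {A : H →ₗ.[ℂ] H} (hA : IsSelfAdjoint A)
    {z : ℂ} (hz : z.im ≠ 0) : IsResolventAt A z (resolvent A z) := by
  suffices h : ∃ R : H →L[ℂ] H, IsResolventAt A z R by
    rw [resolvent, dif_pos h]; exact h.choose_spec
  have hz' : 0 < |z.im| := abs_pos.mpr hz
  let S : A.domain →ₗ[ℂ] H := A.toFun - z • A.domain.subtype
  have hS : ∀ x : A.domain, S x = A x - z • (x : H) := fun x => rfl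
  have hinj : Function.Injective S := by
    rw [injective_iff_map_eq_zero]
    intro x hx
    have h := norm_le_of_isSelfAdjoint hA z x
    rw [← hS, hx, norm_zero] at h
    have h' : ‖(x : H)‖ = 0 := le_antisymm (by nlinarith [norm_nonneg (x : H)]) (norm_nonneg _)
    exact Subtype.ext (norm_eq_zero.mp h')
  have hclosed : IsClosed (S.range : Set H) := by
    have hg : IsClosed (A.graph : Set (H × H)) := hA.isClosed
    have : CompleteSpace A.graph := hg.completeSpace_coe
    let φ : A.graph →L[ℂ] H :=
      (ContinuousLinearMap.snd ℂ H H - z • ContinuousLinearMap.fst ℂ H H).comp A.graph.subtypeL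
    have hφ : ∀ p : A.graph, φ p = p.1.2 - z • p.1.1 := fun p => rfl
    have hb : ∀ p : A.graph,
        ‖p‖ ≤ (Real.toNNReal (1 + (1 + ‖z‖) / |z.im|) : ℝ) * ‖φ p‖ := by
      intro p
      obtain ⟨x, hx1, hx2⟩ := (LinearPMap.mem_graph_iff A).mp p.2
      have h := norm_le_of_isSelfAdjoint hA z x
      rw [hx1, hx2, ← hφ] at h
      have h1 : ‖p.1.1‖ ≤ ‖φ p‖ / |z.im| := by rw [le_div_iff₀ hz']; linarith
      have h2 : ‖p.1.2‖ ≤ ‖φ p‖ + ‖z‖ * ‖p.1.1‖ := by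
        have : p.1.2 = φ p + z • p.1.1 := by rw [hφ]; abel
        calc ‖p.1.2‖ = ‖φ p + z • p.1.1‖ := by rw [← this]
          _ ≤ _ := (norm_add_le _ _).trans (by rw [norm_smul])
      rw [Real.coe_toNNReal _ (by positivity)]
      have h3 : ‖p‖ = max ‖p.1.1‖ ‖p.1.2‖ := rfl
      have h4 : (1 + (1 + ‖z‖) / |z.im|) * ‖φ p‖
          = ‖φ p‖ + ‖φ p‖ / |z.im| + ‖z‖ * (‖φ p‖ / |z.im|) := by ring
      have h5 : ‖z‖ * ‖p.1.1‖ ≤ ‖z‖ * (‖φ p‖ / |z.im|) :=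
        mul_le_mul_of_nonneg_left h1 (norm_nonneg z)
      have h6 : 0 ≤ ‖φ p‖ / |z.im| := by positivity
      have h7 : 0 ≤ ‖z‖ * (‖φ p‖ / |z.im|) := by positivity
      rw [h3, h4]
      exact max_le (by linarith [norm_nonneg (φ p)]) (by linarith)
    have hr : Set.range φ = (S.range : Set H) := by
      ext y
      constructor
      · rintro ⟨p, rfl⟩
        obtain ⟨x, hx1, hx2⟩ := (LinearPMap.mem_graph_iff A).mp p.2
        exact ⟨x, by rw [hS, hφ, hx1, hx2]⟩
      · rintro ⟨x, rfl⟩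
        exact ⟨⟨((x : H), A x), A.mem_graph x⟩, rfl⟩
    rw [← hr]
    exact (AddMonoidHomClass.antilipschitz_of_bound φ hb).isClosed_range φ.uniformContinuous
  have hsurj : S.range = ⊤ := by
    have : CompleteSpace S.range := hclosed.completeSpace_coe
    rw [← Submodule.orthogonal_eq_bot_iff, Submodule.eq_bot_iff]
    intro y hy
    have h1 : ∀ x : A.domain,
        inner ℂ ((starRingEnd ℂ z) • y) (x : H) = inner ℂ y (A x) := by
      intro x
      have h := (Submodule.mem_orthogonal' _ _).mp hy (S x) ⟨x, rfl⟩
      rw [hS, inner_sub_right, inner_smul_right, sub_eq_zero] at h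
      rw [inner_smul_left, Complex.conj_conj, h]
    have hmem : y ∈ A.adjoint.domain := LinearPMap.mem_adjoint_domain_of_exists y ⟨_, h1⟩
    have hval : A.adjoint ⟨y, hmem⟩ = (starRingEnd ℂ z) • y :=
      LinearPMap.adjoint_apply_eq hA.dense_domain _ h1
    have hgr : (y, (starRingEnd ℂ z) • y) ∈ A.graph := by
      rw [← LinearPMap.isSelfAdjoint_def.mp hA, ← hval]
      exact LinearPMap.mem_graph _ ⟨y, hmem⟩
    obtain ⟨x, hx1, hx2⟩ := (LinearPMap.mem_graph_iff A).mp hgr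
    have h := norm_le_of_isSelfAdjoint hA (starRingEnd ℂ z) x
    rw [hx2, hx1] at h
    simp only [sub_self, norm_zero, Complex.conj_im, abs_neg] at h
    have h' : ‖y‖ = 0 := le_antisymm (by nlinarith [norm_nonneg y]) (norm_nonneg _)
    exact norm_eq_zero.mp h'
  let e : A.domain ≃ₗ[ℂ] H := LinearEquiv.ofBijective S ⟨hinj, LinearMap.range_eq_top.mp hsurj⟩
  let R : H →L[ℂ] H := (A.domain.subtype ∘ₗ e.symm.toLinearMap).mkContinuous (1 / |z.im|) (by
    intro y
    have h := norm_le_of_isSelfAdjoint hA z (e.symm y)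
    have h2 : A (e.symm y) - z • ((e.symm y : A.domain) : H) = y := e.apply_symm_apply y
    rw [h2] at h
    change ‖((e.symm y : A.domain) : H)‖ ≤ _
    rw [one_div, ← div_eq_inv_mul, le_div_iff₀ hz']
    linarith)
  refine ⟨R, fun x => ?_, fun y => ⟨e.symm y, rfl, e.apply_symm_apply y⟩⟩
  change ((e.symm (e x) : A.domain) : H) = x
  rw [e.symm_apply_apply]

end Resolvent

section NegativeSquares

/-- The number of negative squares of the Hermitian form `q` on `ℂᵐ`: the largest dimension of a
linear subspace on which `q` is negative definite. -/
def negSquares {m : ℕ} (q : (Fin m → ℂ) → ℝ) : ℕ :=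
  sSup {r | ∃ L : Submodule ℂ (Fin m → ℂ),
    Module.finrank ℂ L = r ∧ ∀ ξ ∈ L, ξ ≠ 0 → q ξ < 0}

/-- The supremum in the definition of `negSquares` is attained. -/
theorem negSquares_isGreatest {m : ℕ} (q : (Fin m → ℂ) → ℝ) :
    IsGreatest {r | ∃ L : Submodule ℂ (Fin m → ℂ),
      Module.finrank ℂ L = r ∧ ∀ ξ ∈ L, ξ ≠ 0 → q ξ < 0} (negSquares q) := by
  have hb : BddAbove {r | ∃ L : Submodule ℂ (Fin m → ℂ),
      Module.finrank ℂ L = r ∧ ∀ ξ ∈ L, ξ ≠ 0 → q ξ < 0} := by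
    refine ⟨m, ?_⟩
    rintro r ⟨L, rfl, -⟩
    simpa using Submodule.finrank_le L
  refine ⟨Nat.sSup_mem ⟨0, ⊥, finrank_bot ℂ _, ?_⟩ hb, fun r hr => le_csSup hb hr⟩
  intro ξ hξ h0
  exact absurd ((Submodule.mem_bot ℂ).mp hξ) h0

end NegativeSquares

section Classes

variable {E : Type*} [NormedAddCommGroup E] [InnerProductSpace ℂ E]

/-- `Z_V`: the set of nonreal points at which `V` is holomorphic. A function meromorphic in
`ℂ ∖ ℝ` is represented by a total function, whose values at the poles (and on `ℝ`) play no role. -/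
def holDomain (V : ℂ → E →L[ℂ] E) : Set ℂ :=
  {z | z.im ≠ 0 ∧ AnalyticAt ℂ V z}

variable [CompleteSpace E]

/-- The kernel `N_V(z, ζ) = (V(ζ) - V(z)^*) / (ζ - z̄)`, extended by continuity
to `ζ = z̄`, where `V(z)^* = V(z̄) = V(ζ)` and the value is `V'(ζ)`. -/
def kernelN (V : ℂ → E →L[ℂ] E) (z ζ : ℂ) : E →L[ℂ] E :=
  open Classical in
  if ζ = starRingEnd ℂ z then deriv V ζ
  else (ζ - starRingEnd ℂ z)⁻¹ • (V ζ - ContinuousLinearMap.adjoint (V z))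

/-- The form `∑_{j,k} (N_V(z_j, z_k) h_j, h_k) ξ_j ξ̄_k`. It is real for functions `V` with
`V(z̄) = V(z)^*`. In the notation of the comments `(x, y)` is linear in `x`, so that it is
`inner ℂ y x`. -/
def kernelForm (V : ℂ → E →L[ℂ] E) {m : ℕ} (z : Fin m → ℂ) (h : Fin m → E)
    (ξ : Fin m → ℂ) : ℝ :=
  (∑ j, ∑ k, inner ℂ (h k) (kernelN V (z j) (z k) (h j)) * ξ j * starRingEnd ℂ (ξ k)).re

/-- The Krein-Langer class `N_κ` of generalized Nevanlinna functions with values in `[E, E]`. -/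
structure IsN (κ : ℕ) (V : ℂ → E →L[ℂ] E) : Prop where
  meromorphic : MeromorphicOn V {z : ℂ | z.im ≠ 0}
  symmetric : ∀ z ∈ holDomain V, V (starRingEnd ℂ z) = ContinuousLinearMap.adjoint (V z)
  negSquares_le : ∀ (n : ℕ) (z : Fin (n + 1) → ℂ) (h : Fin (n + 1) → E),
    (∀ j, z j ∈ holDomain V) → negSquares (kernelForm V z h) ≤ κ
  negSquares_eq : ∃ (n : ℕ) (z : Fin (n + 1) → ℂ) (h : Fin (n + 1) → E),
    (∀ j, z j ∈ holDomain V) ∧ negSquares (kernelForm V z h) = κ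

/-- The imaginary part `(T - T^*) / (2i)` of a bounded operator. -/
def imPart (T : E →L[ℂ] E) : E →L[ℂ] E :=
  (2 * Complex.I)⁻¹ • (T - ContinuousLinearMap.adjoint T)

/-- The set `𝓑` of all `f` for which `y (Im V(iy) f, f)` has a finite limit as `y ↑ ∞`. -/
def setB (V : ℂ → E →L[ℂ] E) : Set E :=
  {f | ∃ c : ℝ, Tendsto
    (fun y : ℝ => y * (inner ℂ f (imPart (V (Complex.I * y)) f)).re) atTop (𝓝 c)}

/-- The class `N_κ(R)` of realizable functions, for a finite-dimensional space `E`. -/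
structure IsNR [FiniteDimensional ℂ E] (κ : ℕ) (V : ℂ → E →L[ℂ] E) : Prop where
  isN : IsN κ V
  tendsto_div : ∀ f : E,
    Tendsto (fun y : ℝ => inner ℂ f (V (Complex.I * y) f) / (y : ℂ)) atTop (𝓝 0)
  kernel_trivial : ∀ z ∈ holDomain V,
    ⨅ ζ ∈ holDomain V, LinearMap.ker (kernelN V ζ z).toLinearMap = ⊥
  tendsto_zero : ∀ f ∈ setB V, Tendsto (fun y : ℝ => V (Complex.I * y) f) atTop (𝓝 0)

/-- The subclass `N¹_κ(R)`, given by `𝓑 = E`. -/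
structure IsN1R [FiniteDimensional ℂ E] (κ : ℕ) (V : ℂ → E →L[ℂ] E) : Prop where
  isNR : IsNR κ V
  setB_eq : setB V = Set.univ

end Classes

section Functions

variable {H₀ N : Type*} [NormedAddCommGroup H₀] [InnerProductSpace ℂ H₀] [CompleteSpace H₀]
  [NormedAddCommGroup N] [InnerProductSpace ℂ N] [CompleteSpace N]

/-- The operator `D + B (A₀ - z)⁻¹ B^* - z`. -/
def schurComplement (A₀ : H₀ →ₗ.[ℂ] H₀) (B : H₀ →L[ℂ] N) (D : N →L[ℂ] N) (z : ℂ) : N →L[ℂ] N :=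
  D + (B.comp (resolvent A₀ z)).comp (ContinuousLinearMap.adjoint B)
    - z • ContinuousLinearMap.id ℂ N

/-- The function `V(z) = -(D + B (A₀ - z)⁻¹ B^* - z)⁻¹`; `Ring.inverse` is the inverse of an
invertible operator, and is `0` at the poles, where the operator is not invertible. -/
def schurFunction (A₀ : H₀ →ₗ.[ℂ] H₀) (B : H₀ →L[ℂ] N) (D : N →L[ℂ] N) (z : ℂ) : N →L[ℂ] N :=
  -Ring.inverse (schurComplement A₀ B D z)

/-- The scalar function
`-(d + |γ|² ∫_{-1}^{1} ρ(t) / (t - z) dt - z)⁻¹` with the semicircle weight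
`ρ(t) = (2 / π) √(1 - t²)`. -/
def semicircleFunction (d : ℝ) (γ : ℂ) (z : ℂ) : ℂ :=
  -((d : ℂ) + ((‖γ‖ ^ 2 : ℝ) : ℂ) *
      (∫ t in (-1 : ℝ)..1, ((2 / Real.pi * Real.sqrt (1 - t ^ 2) : ℝ) : ℂ) / ((t : ℂ) - z)) - z)⁻¹

end Functions

end KreinLanger

end

/-! Both functions have the form `V = -S⁻¹` with `S(z) = D + Q(z) - z`, where `Q(z) - Q(a) = (z - a)
G(z̄)* G(a)` and `‖Q(z)‖ |Im z| ≤ C`. In (i), `G(z) = (A₀ - z)⁻¹ B*`, by the resolvent identity; in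
(ii), `G(z)` is multiplication by the vector `r(t) / (t - z)` of `L²`, by partial fractions. The
class membership is proved once, for every such `Q` (`isN1R_negInverse`).

From `V(ζ) - V(a) = V(ζ) (S(ζ) - S(a)) V(a)` the kernel is `N_V(z, ζ) = V(ζ) (G(ζ̄)* G(z̄) - 1)
V(z̄)`, so its form is `‖∑ ξⱼ G(z̄ⱼ) V(z̄ⱼ) hⱼ‖² - ‖∑ ξⱼ V(z̄ⱼ) hⱼ‖²`. The subtracted square lives
in `N`, whence at most `dim N` negative squares. Far from the real axis `G` is a strict contraction,
so the bound is attained and the kernels have no common null vector. There `S(z)` is also dominated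
by `-z`: hence `V(iy) f → 0` and `y V(iy) f → -i f`, which gives `𝓑 = E`.

Since `S` is invertible far from the axis in each half-plane, its determinant vanishes identically
in neither; `V` is therefore meromorphic and holomorphic exactly where `S` is invertible.

For the closed form, `t = cos θ` and the Joukowski parameter `u = z - w`, `|u| < 1`, turn the
semicircle integral into a mean value over the unit circle. -/

noncomputable section

namespace KreinLanger

/-! ### Inverses of holomorphic operator families in finite dimension -/

section InverseOfFamily

variable {N : Type*} [NormedAddCommGroup N] [InnerProductSpace ℂ N]

theorem map_ringInverse {R S F : Type*} [MonoidWithZero R] [MonoidWithZero S] [EquivLike F R S]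
    [MulEquivClass F R S] (f : F) (a : R) : f (Ring.inverse a) = Ring.inverse (f a) := by
  by_cases ha : IsUnit a
  · have h : f a * f (Ring.inverse a) = 1 := by
      rw [← map_mul, Ring.mul_inverse_cancel _ ha, map_one]
    rw [← Ring.inverse_mul_cancel_left (f a) (f (Ring.inverse a)) (ha.map f), h, mul_one]
  · rw [Ring.inverse_non_unit _ ha, Ring.inverse_non_unit _ (fun h => ha ?_), map_zero]
    exact (MulEquiv.isUnit_map f).mp h

theorem analyticAt_matrix_det {n : Type*} [Fintype n] [DecidableEq n] {M : ℂ → Matrix n n ℂ}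
    {z : ℂ} (hM : ∀ i j, AnalyticAt ℂ (fun w => M w i j) z) :
    AnalyticAt ℂ (fun w => (M w).det) z := by
  simp only [Matrix.det_apply']
  refine Finset.analyticAt_fun_sum _ fun σ _ => analyticAt_const.mul ?_
  exact Finset.analyticAt_fun_prod _ fun i _ => hM _ _

theorem analyticAt_matrix_adjugate {n : Type*} [Fintype n] [DecidableEq n] {M : ℂ → Matrix n n ℂ}
    {z : ℂ} (hM : ∀ i j, AnalyticAt ℂ (fun w => M w i j) z) (i j : n) :
    AnalyticAt ℂ (fun w => (M w).adjugate i j) z := by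
  simp only [Matrix.adjugate_apply]
  refine analyticAt_matrix_det fun k l => ?_
  by_cases h : k = j
  · subst h
    simpa only [Matrix.updateRow_self] using analyticAt_const
  · simpa only [Matrix.updateRow_ne h] using hM k l

variable [FiniteDimensional ℂ N]

/-- Bounded operators on a finite-dimensional space as matrices. -/
def matrixEquiv (N : Type*) [NormedAddCommGroup N] [InnerProductSpace ℂ N]
    [FiniteDimensional ℂ N] :
    (N →L[ℂ] N) ≃ₐ[ℂ] Matrix (Fin (Module.finrank ℂ N)) (Fin (Module.finrank ℂ N)) ℂ :=
  (Module.End.toContinuousLinearMap N).symm.trans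
    (LinearMap.toMatrixAlgEquiv (stdOrthonormalBasis ℂ N).toBasis)

theorem matrixEquiv_apply (T : N →L[ℂ] N) (i j : Fin (Module.finrank ℂ N)) :
    matrixEquiv N T i j
      = inner ℂ (stdOrthonormalBasis ℂ N i) (T (stdOrthonormalBasis ℂ N j)) := by
  change LinearMap.toMatrixAlgEquiv (stdOrthonormalBasis ℂ N).toBasis (T : N →ₗ[ℂ] N) i j = _
  rw [LinearMap.toMatrixAlgEquiv_apply]
  simp [OrthonormalBasis.repr_apply_apply]

theorem analyticAt_matrixEquiv {S : ℂ → N →L[ℂ] N} {z : ℂ} (hS : AnalyticAt ℂ S z)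
    (i j : Fin (Module.finrank ℂ N)) : AnalyticAt ℂ (fun w => matrixEquiv N (S w) i j) z := by
  simp only [matrixEquiv_apply]
  exact (((innerSL ℂ (stdOrthonormalBasis ℂ N i)).comp
    (ContinuousLinearMap.apply ℂ N (stdOrthonormalBasis ℂ N j))).analyticAt (S z)).fun_comp hS

theorem isUnit_iff_det_ne_zero (T : N →L[ℂ] N) : IsUnit T ↔ (matrixEquiv N T).det ≠ 0 := by
  rw [← MulEquiv.isUnit_map (matrixEquiv N), Matrix.isUnit_iff_isUnit_det, isUnit_iff_ne_zero]

/-- The inverse of a holomorphic family of operators on a finite-dimensional space is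
meromorphic. -/
theorem meromorphicAt_ringInverse {S : ℂ → N →L[ℂ] N} {z : ℂ} (hS : AnalyticAt ℂ S z) :
    MeromorphicAt (fun w => Ring.inverse (S w)) z := by
  -- Cramer's rule. It also holds where `S w` is singular: both sides are then `0`.
  have h : ∀ w, Ring.inverse (S w) = ∑ i, ∑ j,
      ((matrixEquiv N (S w)).det⁻¹ * (matrixEquiv N (S w)).adjugate i j) •
        (matrixEquiv N).symm (Matrix.single i j 1) := by
    intro w
    apply (matrixEquiv N).injective
    rw [map_ringInverse, ← Matrix.nonsing_inv_eq_ringInverse, Matrix.inv_def,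
      Ring.inverse_eq_inv]
    conv_lhs => rw [Matrix.matrix_eq_sum_single (_ • _)]
    simp [map_sum, Matrix.smul_single]
  simp only [h]
  refine MeromorphicAt.fun_sum fun i _ => MeromorphicAt.fun_sum fun j _ => ?_
  refine MeromorphicAt.fun_smul (MeromorphicAt.fun_mul ?_ ?_) (MeromorphicAt.const _ _)
  · exact (analyticAt_matrix_det (analyticAt_matrixEquiv hS)).meromorphicAt.fun_inv
  · exact (analyticAt_matrix_adjugate (analyticAt_matrixEquiv hS) i j).meromorphicAt

/-- A holomorphic family of operators on a connected open set which is invertible at one point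
is invertible at points arbitrarily close to every point. -/
theorem frequently_isUnit_of_isUnit {S : ℂ → N →L[ℂ] N} {U : Set ℂ} (hU : IsPreconnected U)
    (hS : AnalyticOnNhd ℂ S U) {z₀ z : ℂ} (hz₀ : z₀ ∈ U) (h : IsUnit (S z₀)) (hz : z ∈ U) :
    ∃ᶠ w in 𝓝[≠] z, IsUnit (S w) := by
  intro hcon
  have hdet : AnalyticOnNhd ℂ (fun w => (matrixEquiv N (S w)).det) U :=
    fun w hw => analyticAt_matrix_det (analyticAt_matrixEquiv (hS w hw))
  refine (isUnit_iff_det_ne_zero _).mp h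
    (hdet.eqOn_zero_of_preconnected_of_frequently_eq_zero hU hz ?_ hz₀)
  refine Eventually.frequently (hcon.mono fun w hw => ?_)
  by_contra h0
  exact hw ((isUnit_iff_det_ne_zero _).mpr h0)

end InverseOfFamily

/-- `Q` is the `Q`-function built with the family `G` of operators: the Nevanlinna kernel of `Q`
factors through `G`. -/
structure IsQFunction {H N : Type*} [NormedAddCommGroup H] [InnerProductSpace ℂ H]
    [CompleteSpace H] [NormedAddCommGroup N] [InnerProductSpace ℂ N] [CompleteSpace N]
    (Q : ℂ → N →L[ℂ] N) (G : ℂ → N →L[ℂ] H) (C : ℝ) : Prop where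
  adjoint_eq : ∀ z : ℂ, z.im ≠ 0 →
    ContinuousLinearMap.adjoint (Q z) = Q (starRingEnd ℂ z)
  sub_eq : ∀ z a : ℂ, z.im ≠ 0 → a.im ≠ 0 → Q z - Q a =
    (z - a) • (ContinuousLinearMap.adjoint (G (starRingEnd ℂ z))).comp (G a)
  norm_le : ∀ z : ℂ, z.im ≠ 0 → ‖Q z‖ * |z.im| ≤ C

/-! ### Bounds, continuity and derivative of a `Q`-function -/

namespace IsQFunction

variable {H N : Type*} [NormedAddCommGroup H] [InnerProductSpace ℂ H]
  [CompleteSpace H] [NormedAddCommGroup N] [InnerProductSpace ℂ N] [CompleteSpace N]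
  {Q : ℂ → N →L[ℂ] N} {G : ℂ → N →L[ℂ] H} {C : ℝ}

theorem nonneg (hQ : IsQFunction Q G C) : 0 ≤ C :=
  (mul_nonneg (norm_nonneg _) (abs_nonneg _)).trans (hQ.norm_le Complex.I (by simp))

theorem adjoint_comp (hQ : IsQFunction Q G C) {w z : ℂ} (hw : w.im ≠ 0) (hz : z.im ≠ 0)
    (hne : starRingEnd ℂ w ≠ z) :
    (ContinuousLinearMap.adjoint (G w)).comp (G z)
      = (starRingEnd ℂ w - z)⁻¹ • (Q (starRingEnd ℂ w) - Q z) := by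
  have h := hQ.sub_eq (starRingEnd ℂ w) z (by simpa using hw) hz
  rw [Complex.conj_conj] at h
  rw [h, smul_smul, inv_mul_cancel₀ (sub_ne_zero.mpr hne), one_smul]

theorem conj_ne_self {z : ℂ} (hz : z.im ≠ 0) : starRingEnd ℂ z ≠ z :=
  fun h => hz (Complex.conj_eq_iff_im.mp h)

theorem norm_conj_sub_self (z : ℂ) : ‖starRingEnd ℂ z - z‖ = 2 * |z.im| := by
  have : starRingEnd ℂ z - z = ((-2 * z.im : ℝ) : ℂ) * Complex.I := by
    apply Complex.ext <;> simp
    ring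
  rw [this]
  simp

/-- The factorization at the pair `z̄, z` gives `2 |Im z| ‖G z‖² = ‖Q(z̄) - Q(z)‖ ≤ 2C / |Im z|`. -/
theorem norm_mul_le (hQ : IsQFunction Q G C) {z : ℂ} (hz : z.im ≠ 0) :
    ‖G z‖ * |z.im| ≤ √C := by
  apply Real.le_sqrt_of_sq_le
  have hz' : 0 < |z.im| := abs_pos.mpr hz
  have h1 := hQ.norm_le z hz
  have h2 := hQ.norm_le (starRingEnd ℂ z) (by simpa using hz)
  simp only [Complex.conj_im, abs_neg] at h2
  have h3 := congrArg norm (hQ.sub_eq (starRingEnd ℂ z) z (by simpa using hz) hz)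
  rw [Complex.conj_conj, norm_smul, norm_conj_sub_self,
    ContinuousLinearMap.norm_adjoint_comp_self] at h3
  have h4 := norm_sub_le (Q (starRingEnd ℂ z)) (Q z)
  rw [h3] at h4
  nlinarith [mul_le_mul_of_nonneg_right h4 hz'.le]

theorem norm_adjoint_comp_le (hQ : IsQFunction Q G C) {w z : ℂ} (hw : w.im ≠ 0)
    (hz : z.im ≠ 0) :
    ‖(ContinuousLinearMap.adjoint (G w)).comp (G z)‖ ≤ C / (|w.im| * |z.im|) := by
  have hw' : 0 < |w.im| := abs_pos.mpr hw
  have hz' : 0 < |z.im| := abs_pos.mpr hz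
  rw [le_div_iff₀ (by positivity)]
  have h := ContinuousLinearMap.opNorm_comp_le (ContinuousLinearMap.adjoint (G w)) (G z)
  rw [LinearIsometryEquiv.norm_map] at h
  calc _ ≤ ‖G w‖ * ‖G z‖ * (|w.im| * |z.im|) := by gcongr
    _ = (‖G w‖ * |w.im|) * (‖G z‖ * |z.im|) := by ring
    _ ≤ √C * √C := mul_le_mul (hQ.norm_mul_le hw) (hQ.norm_mul_le hz) (by positivity)
        (Real.sqrt_nonneg _)
    _ = C := Real.mul_self_sqrt hQ.nonneg

theorem eventually_im_ne_zero {z : ℂ} (hz : z.im ≠ 0) : ∀ᶠ w : ℂ in 𝓝 z, w.im ≠ 0 :=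
  Complex.continuous_im.continuousAt.eventually_ne hz

theorem isOpen_im_ne_zero : IsOpen {z : ℂ | z.im ≠ 0} :=
  isOpen_ne_fun Complex.continuous_im continuous_const

theorem continuousAt (hQ : IsQFunction Q G C) {z : ℂ} (hz : z.im ≠ 0) : ContinuousAt Q z := by
  rw [ContinuousAt, tendsto_iff_norm_sub_tendsto_zero]
  have hlim : Tendsto (fun w : ℂ => ‖w - z‖ * (C / (|w.im| * |z.im|))) (𝓝 z) (𝓝 0) := by
    have h : ContinuousAt (fun w : ℂ => ‖w - z‖ * (C / (|w.im| * |z.im|))) z := by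
      refine ContinuousAt.mul (by fun_prop) (ContinuousAt.div (by fun_prop) ?_ ?_)
      · exact ((Complex.continuous_im.abs).mul continuous_const).continuousAt
      · exact mul_ne_zero (abs_ne_zero.mpr hz) (abs_ne_zero.mpr hz)
    simpa [ContinuousAt] using h
  refine squeeze_zero' (Eventually.of_forall fun _ => norm_nonneg _) ?_ hlim
  filter_upwards [eventually_im_ne_zero hz] with w hw
  rw [hQ.sub_eq w z hw hz, norm_smul]
  have h := hQ.norm_adjoint_comp_le (w := starRingEnd ℂ w) (by simpa using hw) hz
  rw [Complex.conj_im, abs_neg] at h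
  gcongr

/-- `‖G w - G z‖²` is the norm of `(G w - G z)* (G w - G z)`. Its four terms are difference
quotients of `Q` between points of opposite half-planes, so continuity of `Q` suffices. -/
theorem continuousAt_factor (hQ : IsQFunction Q G C) {z : ℂ} (hz : z.im ≠ 0) :
    ContinuousAt G z := by
  have hzc : (starRingEnd ℂ z).im ≠ 0 := by simpa using hz
  have hconj : ContinuousAt (fun w : ℂ => starRingEnd ℂ w) z :=
    Complex.continuous_conj.continuousAt
  have hc : ContinuousAt (fun w => Q (starRingEnd ℂ w)) z :=
    ContinuousAt.comp' (hQ.continuousAt hzc) hconj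
  have hq := hQ.continuousAt hz
  let F : ℂ → N →L[ℂ] N := fun w =>
    (starRingEnd ℂ w - w)⁻¹ • (Q (starRingEnd ℂ w) - Q w)
      - (starRingEnd ℂ w - z)⁻¹ • (Q (starRingEnd ℂ w) - Q z)
      - (starRingEnd ℂ z - w)⁻¹ • (Q (starRingEnd ℂ z) - Q w)
      + (starRingEnd ℂ z - z)⁻¹ • (Q (starRingEnd ℂ z) - Q z)
  have hne : starRingEnd ℂ z - z ≠ 0 := sub_ne_zero.mpr (conj_ne_self hz)
  have hF : ContinuousAt F z := by
    refine ContinuousAt.add (ContinuousAt.sub (ContinuousAt.sub ?_ ?_) ?_) continuousAt_const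
    · exact ((hconj.sub continuousAt_id).inv₀ hne).smul (hc.sub hq)
    · exact ((hconj.sub continuousAt_const).inv₀ hne).smul (hc.sub continuousAt_const)
    · exact ((continuousAt_const.sub continuousAt_id).inv₀ hne).smul (continuousAt_const.sub hq)
  have hF0 : F z = 0 := by simp [F]
  have hlim : Tendsto (fun w => √‖F w‖) (𝓝 z) (𝓝 0) := by
    have h := (Real.continuous_sqrt.continuousAt (x := ‖F z‖)).comp
      (f := fun w => ‖F w‖) hF.norm
    simpa [ContinuousAt, hF0, Function.comp_def] using h
  rw [ContinuousAt, tendsto_iff_norm_sub_tendsto_zero]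
  refine hlim.congr' ?_
  have e1 : ∀ᶠ w in 𝓝 z, starRingEnd ℂ w ≠ z := hconj.eventually_ne (conj_ne_self hz)
  filter_upwards [eventually_im_ne_zero hz, e1] with w hw hwz
  have hzw : starRingEnd ℂ z ≠ w := fun h => hwz (by rw [← h, Complex.conj_conj])
  have : F w = (ContinuousLinearMap.adjoint (G w - G z)).comp (G w - G z) := by
    simp only [F]
    rw [← hQ.adjoint_comp hw hw (conj_ne_self hw), ← hQ.adjoint_comp hw hz hwz,
      ← hQ.adjoint_comp hz hw hzw, ← hQ.adjoint_comp hz hz (conj_ne_self hz)]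
    simp only [map_sub, ContinuousLinearMap.comp_sub, ContinuousLinearMap.sub_comp]
    abel
  rw [this, ContinuousLinearMap.norm_adjoint_comp_self, Real.sqrt_mul_self (norm_nonneg _)]

/-- The slope from `z` to `w` equals `G(w̄)* G(z)`, and `G` is continuous. -/
theorem hasDerivAt (hQ : IsQFunction Q G C) {z : ℂ} (hz : z.im ≠ 0) :
    HasDerivAt Q ((ContinuousLinearMap.adjoint (G (starRingEnd ℂ z))).comp (G z)) z := by
  rw [hasDerivAt_iff_tendsto_slope]
  have hzc : (starRingEnd ℂ z).im ≠ 0 := by simpa using hz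
  have h1 : ContinuousAt (fun w => G (starRingEnd ℂ w)) z :=
    ContinuousAt.comp' (hQ.continuousAt_factor hzc) Complex.continuous_conj.continuousAt
  have h2 : ContinuousAt
      (fun w => (ContinuousLinearMap.adjoint (G (starRingEnd ℂ w))).comp (G z)) z :=
    ((ContinuousLinearMap.adjoint (𝕜 := ℂ)).continuous.continuousAt.comp'
      (f := fun w => G (starRingEnd ℂ w)) h1).clm_comp continuousAt_const
  refine (h2.tendsto.mono_left nhdsWithin_le_nhds).congr' ?_
  filter_upwards [(eventually_im_ne_zero hz).filter_mono nhdsWithin_le_nhds,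
    self_mem_nhdsWithin] with w hw hwz
  rw [slope_def_module, hQ.sub_eq w z hw hz, smul_smul,
    inv_mul_cancel₀ (sub_ne_zero.mpr hwz), one_smul]

end IsQFunction

end KreinLanger

end

/-! ### The function `-(D + Q(z) - z)⁻¹` and the class `N¹_κ(R)` -/

noncomputable section

namespace KreinLanger

variable {H N : Type*} [NormedAddCommGroup H] [InnerProductSpace ℂ H]
  [CompleteSpace H] [NormedAddCommGroup N] [InnerProductSpace ℂ N]
  {Q : ℂ → N →L[ℂ] N} {G : ℂ → N →L[ℂ] H} {C : ℝ} {D : N →L[ℂ] N}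

/-- The operator `D + Q(z) - z`. -/
def pencil (D : N →L[ℂ] N) (Q : ℂ → N →L[ℂ] N) (z : ℂ) : N →L[ℂ] N :=
  D + Q z - z • ContinuousLinearMap.id ℂ N

/-- The function `-(D + Q(z) - z)⁻¹`. -/
def negInverse (D : N →L[ℂ] N) (Q : ℂ → N →L[ℂ] N) (z : ℂ) : N →L[ℂ] N :=
  -Ring.inverse (pencil D Q z)

theorem pencil_mul_negInverse {z : ℂ} (h : IsUnit (pencil D Q z)) :
    pencil D Q z * negInverse D Q z = -1 := by
  rw [negInverse, mul_neg, Ring.mul_inverse_cancel _ h]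

theorem negInverse_mul_pencil {z : ℂ} (h : IsUnit (pencil D Q z)) :
    negInverse D Q z * pencil D Q z = -1 := by
  rw [negInverse, neg_mul, Ring.inverse_mul_cancel _ h]

theorem negInverse_injective {z : ℂ} (h : IsUnit (pencil D Q z)) :
    Function.Injective (negInverse D Q z) := by
  intro x y hxy
  have h1 : ∀ x, x = -(pencil D Q z) (negInverse D Q z x) := fun x => by
    rw [← mul_apply_eq_comp, pencil_mul_negInverse h]
    simp
  rw [h1 x, h1 y, hxy]

theorem norm_sum_smul_sq {F : Type*} [NormedAddCommGroup F] [InnerProductSpace ℂ F] {m : ℕ}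
    (ξ : Fin m → ℂ) (v : Fin m → F) : ‖∑ j, ξ j • v j‖ ^ 2
      = (∑ j, ∑ k, inner ℂ (v k) (v j) * ξ j * starRingEnd ℂ (ξ k)).re := by
  rw [norm_sq_eq_re_inner (𝕜 := ℂ), inner_sum]
  simp only [sum_inner, inner_smul_left, inner_smul_right, RCLike.re_eq_complex_re]
  congr 1
  refine Finset.sum_congr rfl fun j _ => ?_
  rw [Finset.mul_sum]
  exact Finset.sum_congr rfl fun k _ => by ring

theorem eventually_le_I_mul (K : ℝ) : ∀ᶠ y : ℝ in atTop, K ≤ |(Complex.I * y : ℂ).im| := by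
  filter_upwards [eventually_ge_atTop K] with y hy
  simpa using hy.trans (le_abs_self y)

variable [CompleteSpace N]

theorem inner_imPart_re (T : N →L[ℂ] N) (f : N) :
    (inner ℂ f (imPart T f)).re = (inner ℂ f (T f)).im := by
  have h : inner ℂ f (ContinuousLinearMap.adjoint T f) = starRingEnd ℂ (inner ℂ f (T f)) := by
    rw [ContinuousLinearMap.adjoint_inner_right, inner_conj_symm]
  rw [imPart, smul_apply, sub_apply, inner_smul_right,
    inner_sub_right, h, Complex.sub_conj]
  have h2 : (2 * Complex.I)⁻¹ * (((2 * (inner ℂ f (T f)).im : ℝ) : ℂ) * Complex.I)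
      = (((inner ℂ f (T f)).im : ℝ) : ℂ) := by
    field_simp
    push_cast
    ring
  rw [h2, Complex.ofReal_re]

namespace IsQFunction

theorem adjoint_pencil (hQ : IsQFunction Q G C) (hD : IsSelfAdjoint D) {z : ℂ} (hz : z.im ≠ 0) :
    ContinuousLinearMap.adjoint (pencil D Q z) = pencil D Q (starRingEnd ℂ z) := by
  simp only [pencil, map_sub, map_add, hQ.adjoint_eq z hz, map_smulₛₗ,
    ContinuousLinearMap.isSelfAdjoint_iff'.mp hD, ContinuousLinearMap.adjoint_id]

theorem isUnit_pencil_conj (hQ : IsQFunction Q G C) (hD : IsSelfAdjoint D) {z : ℂ}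
    (hz : z.im ≠ 0) (h : IsUnit (pencil D Q z)) : IsUnit (pencil D Q (starRingEnd ℂ z)) := by
  rw [← hQ.adjoint_pencil hD hz, ← ContinuousLinearMap.star_eq_adjoint]
  exact h.star

theorem adjoint_negInverse (hQ : IsQFunction Q G C) (hD : IsSelfAdjoint D) {z : ℂ}
    (hz : z.im ≠ 0) :
    ContinuousLinearMap.adjoint (negInverse D Q z) = negInverse D Q (starRingEnd ℂ z) := by
  rw [negInverse, negInverse, map_neg, ← hQ.adjoint_pencil hD hz,
    ← ContinuousLinearMap.star_eq_adjoint, ← ContinuousLinearMap.star_eq_adjoint]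
  congr 1
  by_cases h : IsUnit (pencil D Q z)
  · obtain ⟨u, hu⟩ := h
    rw [← hu, Ring.inverse_unit, ← Units.coe_star, ← Units.coe_star, Ring.inverse_unit, star_inv]
  · rw [Ring.inverse_non_unit _ h, Ring.inverse_non_unit _ (fun h' => h (isUnit_star.mp h')),
      star_zero]

theorem hasDerivAt_pencil (hQ : IsQFunction Q G C) {z : ℂ} (hz : z.im ≠ 0) :
    HasDerivAt (pencil D Q)
      ((ContinuousLinearMap.adjoint (G (starRingEnd ℂ z))).comp (G z) - 1) z := by
  have h := ((hQ.hasDerivAt hz).const_add D).sub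
    ((hasDerivAt_id z).smul_const (ContinuousLinearMap.id ℂ N))
  rw [one_smul] at h
  exact h

theorem analyticOnNhd_pencil (hQ : IsQFunction Q G C) :
    AnalyticOnNhd ℂ (pencil D Q) {z | z.im ≠ 0} :=
  DifferentiableOn.analyticOnNhd
    (fun _ hz => (hQ.hasDerivAt_pencil hz).differentiableAt.differentiableWithinAt)
    isOpen_im_ne_zero

theorem hasDerivAt_negInverse (hQ : IsQFunction Q G C) {z : ℂ} (hz : z.im ≠ 0)
    (h : IsUnit (pencil D Q z)) :
    HasDerivAt (negInverse D Q) (negInverse D Q z *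
      ((ContinuousLinearMap.adjoint (G (starRingEnd ℂ z))).comp (G z) - 1) *
        negInverse D Q z) z := by
  obtain ⟨u, hu⟩ := h
  have h1 := hasFDerivAt_ringInverse (𝕜 := ℂ) u
  rw [hu] at h1
  have h2 := (h1.comp_hasDerivAt z (hQ.hasDerivAt_pencil hz)).neg
  convert! h2 using 1
  simp [negInverse, ← hu]

theorem isOpen_isUnit_pencil (hQ : IsQFunction Q G C) :
    IsOpen {z : ℂ | z.im ≠ 0 ∧ IsUnit (pencil D Q z)} := by
  rw [isOpen_iff_mem_nhds]
  rintro z ⟨hz, h⟩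
  exact (eventually_im_ne_zero hz).and
    ((hQ.hasDerivAt_pencil hz).continuousAt.eventually (Units.isOpen.mem_nhds h))

theorem analyticAt_negInverse (hQ : IsQFunction Q G C) {z : ℂ} (hz : z.im ≠ 0)
    (h : IsUnit (pencil D Q z)) : AnalyticAt ℂ (negInverse D Q) z := by
  refine DifferentiableOn.analyticAt
    (s := {z : ℂ | z.im ≠ 0 ∧ IsUnit (pencil D Q z)}) (fun w hw => ?_)
    (hQ.isOpen_isUnit_pencil.mem_nhds ⟨hz, h⟩)
  exact (hQ.hasDerivAt_negInverse hw.1 hw.2).differentiableAt.differentiableWithinAt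

/-- For `|Im z| ≥ 1` one has `‖Q z‖ ≤ C`, so `D + Q z` is a bounded perturbation of `-z`. -/
theorem norm_pencil_apply_ge (hQ : IsQFunction Q G C) {z : ℂ} (hz : 1 ≤ |z.im|) (x : N) :
    (|z.im| - (‖D‖ + C)) * ‖x‖ ≤ ‖pencil D Q z x‖ := by
  have hz0 : z.im ≠ 0 := abs_pos.mp (zero_lt_one.trans_le hz)
  have h1 : ‖Q z‖ ≤ C := (le_mul_of_one_le_right (norm_nonneg _) hz).trans (hQ.norm_le z hz0)
  have h2 : z • x = (D x + Q z x) - pencil D Q z x := by simp [pencil]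
  have h3 : ‖z • x‖ ≤ (‖D‖ * ‖x‖ + C * ‖x‖) + ‖pencil D Q z x‖ := by
    rw [h2]
    refine (norm_sub_le _ _).trans (add_le_add_left ((norm_add_le _ _).trans ?_) _)
    exact add_le_add (D.le_opNorm x) (((Q z).le_opNorm x).trans (by gcongr))
  rw [norm_smul] at h3
  nlinarith [mul_le_mul_of_nonneg_right (Complex.abs_im_le_norm z) (norm_nonneg x)]

variable [FiniteDimensional ℂ N]

theorem isUnit_pencil (hQ : IsQFunction Q G C) {z : ℂ} (hz : ‖D‖ + C + 1 ≤ |z.im|) :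
    IsUnit (pencil D Q z) := by
  have hC := hQ.nonneg
  have hinj : Function.Injective (pencil D Q z) := by
    rw [injective_iff_map_eq_zero]
    intro x hx
    have h := hQ.norm_pencil_apply_ge (D := D) (z := z) (by linarith [norm_nonneg D]) x
    rw [hx, norm_zero] at h
    exact norm_eq_zero.mp (le_antisymm (by nlinarith [norm_nonneg x]) (norm_nonneg x))
  rw [ContinuousLinearMap.isUnit_iff_bijective]
  exact ⟨hinj, (LinearMap.injective_iff_surjective (f := (pencil D Q z : N →ₗ[ℂ] N))).mp hinj⟩

theorem norm_negInverse_apply_le (hQ : IsQFunction Q G C) {z : ℂ} (hz : ‖D‖ + C + 1 ≤ |z.im|)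
    (x : N) : ‖negInverse D Q z x‖ ≤ ‖x‖ / (|z.im| - (‖D‖ + C)) := by
  have hC := hQ.nonneg
  have h := hQ.norm_pencil_apply_ge (D := D) (z := z) (by linarith [norm_nonneg D])
    (negInverse D Q z x)
  rw [← mul_apply_eq_comp, pencil_mul_negInverse (hQ.isUnit_pencil hz)] at h
  rw [le_div_iff₀ (by linarith)]
  simpa [mul_comm] using h

/-- The nonreal points form two components, so the identity theorem needs an invertible base point
in each: `±i (‖D‖ + C + 1)`. -/
theorem frequently_isUnit_pencil (hQ : IsQFunction Q G C) {z : ℂ} (hz : z.im ≠ 0) :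
    ∃ᶠ w in 𝓝[≠] z, IsUnit (pencil D Q w) := by
  have hC := hQ.nonneg
  have hK : 0 < ‖D‖ + C + 1 := by linarith [norm_nonneg D]
  rcases lt_or_gt_of_ne hz with h | h
  · refine frequently_isUnit_of_isUnit (U := {z : ℂ | z.im < 0})
      (z₀ := -((‖D‖ + C + 1 : ℝ) * Complex.I))
      (convex_halfSpace_im_lt 0).isPreconnected (fun w hw => hQ.analyticOnNhd_pencil w hw.ne)
      (Set.mem_ofPred.mpr ?_) (hQ.isUnit_pencil ?_) h
    · rw [Complex.neg_im, Complex.im_ofReal_mul, Complex.I_im, mul_one]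
      exact neg_neg_of_pos hK
    · rw [Complex.neg_im, Complex.im_ofReal_mul, Complex.I_im, mul_one, abs_neg]
      exact le_abs_self _
  · refine frequently_isUnit_of_isUnit (U := {z : ℂ | 0 < z.im})
      (z₀ := ((‖D‖ + C + 1 : ℝ) * Complex.I))
      (convex_halfSpace_im_gt 0).isPreconnected (fun w hw => hQ.analyticOnNhd_pencil w hw.ne')
      (by simpa using hK) (hQ.isUnit_pencil ?_) h
    simpa using le_abs_self (‖D‖ + C + 1)

/-- The poles of `-(D + Q(z) - z)⁻¹` are the points where `D + Q(z) - z` is not invertible. -/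
theorem mem_holDomain_iff (hQ : IsQFunction Q G C) {z : ℂ} :
    z ∈ holDomain (negInverse D Q) ↔ z.im ≠ 0 ∧ IsUnit (pencil D Q z) := by
  refine ⟨fun ⟨hz, han⟩ => ⟨hz, ?_⟩, fun ⟨hz, h⟩ => ⟨hz, hQ.analyticAt_negInverse hz h⟩⟩
  have hS : ContinuousAt (pencil D Q) z := (hQ.hasDerivAt_pencil hz).continuousAt
  -- The inverse relations hold at points accumulating at `z` and pass to the limit by continuity.
  -- The default value `0` of the inverse thus cannot create a spurious point of holomorphy.
  have hcl : IsClosed {p : (N →L[ℂ] N) × (N →L[ℂ] N) | p.1 * p.2 = -1 ∧ p.2 * p.1 = -1} :=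
    (isClosed_eq (by fun_prop) (by fun_prop)).inter (isClosed_eq (by fun_prop) (by fun_prop))
  have hmem := hcl.mem_of_frequently_of_tendsto (b := 𝓝[≠] z)
    (f := fun w => (pencil D Q w, negInverse D Q w))
    ((hQ.frequently_isUnit_pencil (D := D) hz).mono fun w hw =>
      ⟨pencil_mul_negInverse hw, negInverse_mul_pencil hw⟩)
    ((hS.prodMk han.continuousAt).tendsto.mono_left nhdsWithin_le_nhds)
  exact ⟨⟨pencil D Q z, -negInverse D Q z, by simp [hmem.1], by simp [hmem.2]⟩, rfl⟩

theorem I_mul_mem_holDomain (hQ : IsQFunction Q G C) {y : ℝ} (hy : ‖D‖ + C + 1 ≤ y) :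
    Complex.I * y ∈ holDomain (negInverse D Q) := by
  have hC := hQ.nonneg
  refine hQ.mem_holDomain_iff.mpr ⟨?_, hQ.isUnit_pencil ?_⟩
  · simp only [Complex.mul_im, Complex.I_re, Complex.I_im, Complex.ofReal_re, Complex.ofReal_im]
    linarith [norm_nonneg D]
  · simpa using hy.trans (le_abs_self y)

/-- Off the diagonal this is the identity `V(ζ) - V(z̄) = V(ζ) (S(ζ) - S(z̄)) V(z̄)` divided by `ζ -
z̄`; at `ζ = z̄` it is the formula for `V'`. -/
theorem kernelN_negInverse (hQ : IsQFunction Q G C) (hD : IsSelfAdjoint D) {z ζ : ℂ}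
    (hz : z ∈ holDomain (negInverse D Q)) (hζ : ζ ∈ holDomain (negInverse D Q)) :
    kernelN (negInverse D Q) z ζ = negInverse D Q ζ *
      ((ContinuousLinearMap.adjoint (G (starRingEnd ℂ ζ))).comp (G (starRingEnd ℂ z)) - 1) *
        negInverse D Q (starRingEnd ℂ z) := by
  obtain ⟨hz0, hzu⟩ := hQ.mem_holDomain_iff.mp hz
  obtain ⟨hζ0, hζu⟩ := hQ.mem_holDomain_iff.mp hζ
  have hzc : (starRingEnd ℂ z).im ≠ 0 := by simpa using hz0
  have hzcu := hQ.isUnit_pencil_conj hD hz0 hzu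
  rw [kernelN]
  split_ifs with h
  · rw [← h]
    exact (hQ.hasDerivAt_negInverse hζ0 hζu).deriv
  · rw [hQ.adjoint_negInverse hD hz0]
    have hne : ζ - starRingEnd ℂ z ≠ 0 := sub_ne_zero.mpr h
    have h1 : pencil D Q ζ - pencil D Q (starRingEnd ℂ z) = (ζ - starRingEnd ℂ z) •
        ((ContinuousLinearMap.adjoint (G (starRingEnd ℂ ζ))).comp (G (starRingEnd ℂ z)) - 1) := by
      rw [smul_sub, ← hQ.sub_eq ζ _ hζ0 hzc, ContinuousLinearMap.one_def, sub_smul]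
      simp only [pencil]
      abel
    have h2 : negInverse D Q ζ - negInverse D Q (starRingEnd ℂ z) = negInverse D Q ζ *
        (pencil D Q ζ - pencil D Q (starRingEnd ℂ z)) * negInverse D Q (starRingEnd ℂ z) := by
      rw [mul_sub, sub_mul, negInverse_mul_pencil hζu, mul_assoc, pencil_mul_negInverse hzcu]
      simp only [neg_mul, one_mul, mul_neg, mul_one]
      abel
    rw [h2, h1, mul_smul_comm, smul_mul_assoc, smul_smul, inv_mul_cancel₀ hne, one_smul]

theorem inner_kernelN (hQ : IsQFunction Q G C) (hD : IsSelfAdjoint D) {z ζ : ℂ}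
    (hz : z ∈ holDomain (negInverse D Q)) (hζ : ζ ∈ holDomain (negInverse D Q)) (h k : N) :
    inner ℂ k (kernelN (negInverse D Q) z ζ h) =
      inner ℂ (G (starRingEnd ℂ ζ) (negInverse D Q (starRingEnd ℂ ζ) k))
          (G (starRingEnd ℂ z) (negInverse D Q (starRingEnd ℂ z) h))
        - inner ℂ (negInverse D Q (starRingEnd ℂ ζ) k) (negInverse D Q (starRingEnd ℂ z) h) := by
  rw [hQ.kernelN_negInverse hD hz hζ, ← hQ.adjoint_negInverse hD (z := ζ) hζ.1]
  simp only [mul_apply_eq_comp, sub_apply,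
    ContinuousLinearMap.comp_apply, one_apply_eq_self]
  rw [← ContinuousLinearMap.adjoint_inner_left, inner_sub_right,
    ContinuousLinearMap.adjoint_inner_right]

/-- The kernel form is the difference of two squares. -/
theorem kernelForm_negInverse (hQ : IsQFunction Q G C) (hD : IsSelfAdjoint D) {m : ℕ}
    {z : Fin m → ℂ} (hz : ∀ j, z j ∈ holDomain (negInverse D Q)) (h : Fin m → N)
    (ξ : Fin m → ℂ) :
    kernelForm (negInverse D Q) z h ξ =
      ‖∑ j, ξ j • G (starRingEnd ℂ (z j)) (negInverse D Q (starRingEnd ℂ (z j)) (h j))‖ ^ 2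
        - ‖∑ j, ξ j • negInverse D Q (starRingEnd ℂ (z j)) (h j)‖ ^ 2 := by
  rw [norm_sum_smul_sq, norm_sum_smul_sq, kernelForm, ← Complex.sub_re,
    ← Finset.sum_sub_distrib]
  congr 1
  refine Finset.sum_congr rfl fun j _ => ?_
  rw [← Finset.sum_sub_distrib]
  refine Finset.sum_congr rfl fun k _ => ?_
  rw [hQ.inner_kernelN hD (hz j) (hz k)]
  ring

/-- Where `∑ ξⱼ V(z̄ⱼ) hⱼ` vanishes the form is nonnegative. This linear map into `N` is therefore
injective on every negative definite subspace. -/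
theorem negSquares_kernelForm_le (hQ : IsQFunction Q G C) (hD : IsSelfAdjoint D) {m : ℕ}
    {z : Fin m → ℂ} (hz : ∀ j, z j ∈ holDomain (negInverse D Q)) (h : Fin m → N) :
    negSquares (kernelForm (negInverse D Q) z h) ≤ Module.finrank ℂ N := by
  obtain ⟨L, hL, hneg⟩ := (negSquares_isGreatest (kernelForm (negInverse D Q) z h)).1
  rw [← hL]
  let W : (Fin m → ℂ) →ₗ[ℂ] N :=
    Fintype.linearCombination ℂ fun j => negInverse D Q (starRingEnd ℂ (z j)) (h j)
  refine LinearMap.finrank_le_finrank_of_injective (f := W.comp L.subtype) ?_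
  rw [injective_iff_map_eq_zero]
  rintro ⟨ξ, hξ⟩ h0
  by_contra hne
  have hlt := hneg ξ hξ fun h => hne (Subtype.ext h)
  have h0' : ∑ j, ξ j • negInverse D Q (starRingEnd ℂ (z j)) (h j) = 0 := h0
  rw [hQ.kernelForm_negInverse hD hz, h0'] at hlt
  simp only [norm_zero] at hlt
  nlinarith [sq_nonneg ‖∑ j, ξ j • G (starRingEnd ℂ (z j))
    (negInverse D Q (starRingEnd ℂ (z j)) (h j))‖]

theorem finrank_le_negSquares_kernelForm (hQ : IsQFunction Q G C) (hD : IsSelfAdjoint D)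
    {m : ℕ} (hm : Module.finrank ℂ N = m) {z : ℂ} (hz : z ∈ holDomain (negInverse D Q))
    (hC : C < |z.im| ^ 2) :
    ∃ h : Fin m → N, m ≤ negSquares (kernelForm (negInverse D Q) (fun _ => z) h) := by
  obtain ⟨hz0, hzu⟩ := hQ.mem_holDomain_iff.mp hz
  have hzc : (starRingEnd ℂ z).im ≠ 0 := by simpa using hz0
  let b := (stdOrthonormalBasis ℂ N).reindex (finCongr hm)
  -- With this choice `V(z̄) hⱼ = bⱼ`, so the form at the repeated point `z` is `‖G(z̄) w‖² - ‖w‖²`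
  -- with `w = ∑ ξⱼ bⱼ`, negative definite on the whole space because `‖G(z̄)‖ < 1`.
  refine ⟨fun j => -pencil D Q (starRingEnd ℂ z) (b j),
    (negSquares_isGreatest _).2 ⟨⊤, by simp, fun ξ _ hξ => ?_⟩⟩
  have hv : ∀ j, negInverse D Q (starRingEnd ℂ z) (-pencil D Q (starRingEnd ℂ z) (b j)) = b j := by
    intro j
    rw [map_neg, ← mul_apply_eq_comp,
      negInverse_mul_pencil (hQ.isUnit_pencil_conj hD hz0 hzu)]
    simp
  rw [hQ.kernelForm_negInverse hD fun _ => hz]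
  simp only [hv, ← map_smul, ← map_sum]
  set w := ∑ j, ξ j • b j with hw
  have hw0 : 0 < ‖w‖ := by
    rw [norm_pos_iff]
    intro h0
    exact hξ (funext (Fintype.linearIndependent_iff.mp b.orthonormal.linearIndependent ξ h0))
  have h1 : ‖G (starRingEnd ℂ z)‖ < 1 := by
    have h2 := hQ.norm_mul_le hzc
    rw [Complex.conj_im, abs_neg] at h2
    have h3 : √C < |z.im| := (Real.sqrt_lt' (abs_pos.mpr hz0)).mpr hC
    by_contra h4
    have := mul_le_mul_of_nonneg_right (not_lt.mp h4) (abs_nonneg z.im)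
    linarith
  have h2 : ‖G (starRingEnd ℂ z) w‖ < ‖w‖ :=
    ((G (starRingEnd ℂ z)).le_opNorm w).trans_lt (by nlinarith)
  nlinarith [norm_nonneg (G (starRingEnd ℂ z) w)]

theorem isN_negInverse (hQ : IsQFunction Q G C) (hD : IsSelfAdjoint D) :
    IsN (Module.finrank ℂ N) (negInverse D Q) where
  meromorphic z hz := (meromorphicAt_ringInverse (hQ.analyticOnNhd_pencil z hz)).neg
  symmetric z hz := (hQ.adjoint_negInverse hD hz.1).symm
  negSquares_le n z h hz := hQ.negSquares_kernelForm_le hD hz h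
  negSquares_eq := by
    have hC := hQ.nonneg
    have hy : Complex.I * ((‖D‖ + C + 1 : ℝ) : ℂ) ∈ holDomain (negInverse D Q) :=
      hQ.I_mul_mem_holDomain le_rfl
    -- The definition asks for at least one point, so dimension `0` is separate: one point and the
    -- vector `0`.
    rcases hm : Module.finrank ℂ N with _ | n
    · exact ⟨0, fun _ => _, 0, fun _ => hy, Nat.le_zero.mp
        ((hQ.negSquares_kernelForm_le hD (fun _ => hy) 0).trans hm.le)⟩
    · obtain ⟨h, hh⟩ := hQ.finrank_le_negSquares_kernelForm hD hm hy (by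
        simp only [Complex.mul_im, Complex.I_re, Complex.I_im, Complex.ofReal_re,
          Complex.ofReal_im, zero_mul, one_mul, zero_add, sq_abs]
        nlinarith [norm_nonneg D])
      exact ⟨n, _, h, fun _ => hy, le_antisymm
        ((hQ.negSquares_kernelForm_le hD (fun _ => hy) h).trans hm.le) hh⟩

theorem tendsto_negInverse_apply (hQ : IsQFunction Q G C) (f : N) :
    Tendsto (fun y : ℝ => negInverse D Q (Complex.I * y) f) atTop (𝓝 0) := by
  have hlim : Tendsto (fun y : ℝ => ‖f‖ / (|y| - (‖D‖ + C))) atTop (𝓝 0) :=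
    Tendsto.const_div_atTop
      (tendsto_atTop_add_const_right _ _ tendsto_abs_atTop_atTop) _
  refine squeeze_zero_norm' ?_ hlim
  filter_upwards [eventually_le_I_mul (‖D‖ + C + 1)] with y hy
  simpa using hQ.norm_negInverse_apply_le hy f

/-- `S V = -1` reads `iy V f = (D + Q) V f + f`. Here `D + Q` stays bounded and `V f → 0`;
multiplying by `-i` gives the limit. -/
theorem tendsto_mul_negInverse_apply (hQ : IsQFunction Q G C) (f : N) :
    Tendsto (fun y : ℝ => (y : ℂ) • negInverse D Q (Complex.I * y) f) atTop
      (𝓝 (-Complex.I • f)) := by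
  have hlim : Tendsto (fun y : ℝ => (D + Q (Complex.I * y)) (negInverse D Q (Complex.I * y) f))
      atTop (𝓝 0) := by
    have h := ((hQ.tendsto_negInverse_apply (D := D) f).norm.const_mul (‖D‖ + C))
    rw [norm_zero, mul_zero] at h
    refine squeeze_zero_norm' ?_ h
    filter_upwards [eventually_le_I_mul 1] with y hy
    refine (ContinuousLinearMap.le_opNorm _ _).trans ?_
    have h1 : ‖Q (Complex.I * y)‖ ≤ C := (le_mul_of_one_le_right (norm_nonneg _) hy).trans
      (hQ.norm_le _ (abs_pos.mp (zero_lt_one.trans_le hy)))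
    have h2 := norm_add_le D (Q (Complex.I * y))
    gcongr
    linarith
  have h3 := (hlim.add_const f).const_smul (-Complex.I)
  rw [zero_add] at h3
  refine h3.congr' ?_
  filter_upwards [eventually_le_I_mul (‖D‖ + C + 1)] with y hy
  have h4 : pencil D Q (Complex.I * y) (negInverse D Q (Complex.I * y) f) = -f := by
    rw [← mul_apply_eq_comp, pencil_mul_negInverse (hQ.isUnit_pencil hy)]
    simp
  have h5 : (D + Q (Complex.I * y)) (negInverse D Q (Complex.I * y) f) + f =
      (Complex.I * y) • negInverse D Q (Complex.I * y) f := by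
    rw [pencil, sub_apply] at h4
    simp only [smul_apply, ContinuousLinearMap.id_apply] at h4
    rw [sub_eq_iff_eq_add.mp h4]
    abel
  rw [h5, smul_smul]
  congr 1
  linear_combination (-(y : ℂ)) * Complex.I_mul_I

theorem setB_negInverse (hQ : IsQFunction Q G C) : setB (negInverse D Q) = Set.univ := by
  refine Set.eq_univ_of_forall fun f => ⟨(inner ℂ f (-Complex.I • f)).im, ?_⟩
  have h := Complex.continuous_im.continuousAt.tendsto.comp
    ((tendsto_const_nhds (x := f)).inner (𝕜 := ℂ) (hQ.tendsto_mul_negInverse_apply (D := D) f))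
  refine h.congr fun y => ?_
  simp only [Function.comp_apply]
  rw [inner_imPart_re, inner_smul_right, Complex.im_ofReal_mul]

/-- A single `ζ = iy` suffices. As `V(z)` is injective, a null vector `f` gives `x = G(z̄)* G(ζ̄) x`
with `x = V(ζ̄) f`, and for large `y` this operator is a strict contraction. -/
theorem ker_kernelN_negInverse (hQ : IsQFunction Q G C) (hD : IsSelfAdjoint D) {z : ℂ}
    (hz : z ∈ holDomain (negInverse D Q)) :
    ⨅ ζ ∈ holDomain (negInverse D Q),
      LinearMap.ker (kernelN (negInverse D Q) ζ z).toLinearMap = ⊥ := by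
  have hC := hQ.nonneg
  obtain ⟨hz0, hzu⟩ := hQ.mem_holDomain_iff.mp hz
  have hz' : 0 < |z.im| := abs_pos.mpr hz0
  have hzc : (starRingEnd ℂ z).im ≠ 0 := by simpa using hz0
  rw [Submodule.eq_bot_iff]
  intro f hf
  -- The first three terms make `S(iy)` invertible; the last makes `C / (|Im z| y) < 1`.
  set y : ℝ := ‖D‖ + C + 1 + C / |z.im| with hy
  have hy0 : ‖D‖ + C + 1 ≤ y := le_add_of_nonneg_right (by positivity)
  have hy1 : C / |z.im| < y := by rw [hy]; linarith [norm_nonneg D]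
  have hypos : 0 < y := by linarith [norm_nonneg D]
  have hζ := hQ.I_mul_mem_holDomain hy0
  set ζ : ℂ := Complex.I * y with hζdef
  have hζim : ζ.im = y := by simp [hζdef]
  have hζc : (starRingEnd ℂ ζ).im ≠ 0 := by simpa using hζ.1
  have h := (Submodule.mem_iInf _).mp ((Submodule.mem_iInf _).mp hf ζ) hζ
  rw [LinearMap.mem_ker] at h
  change kernelN (negInverse D Q) ζ z f = 0 at h
  rw [hQ.kernelN_negInverse hD hζ hz] at h
  simp only [mul_apply_eq_comp] at h
  set x := negInverse D Q (starRingEnd ℂ ζ) f with hx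
  have h1 := (negInverse_injective hzu) (h.trans (map_zero _).symm)
  rw [sub_apply, one_apply_eq_self, sub_eq_zero] at h1
  have h2 := ContinuousLinearMap.le_opNorm
    ((ContinuousLinearMap.adjoint (G (starRingEnd ℂ z))).comp (G (starRingEnd ℂ ζ))) x
  have h3 := hQ.norm_adjoint_comp_le hzc hζc
  simp only [Complex.conj_im, abs_neg, hζim, abs_of_pos hypos] at h3
  have h4 : C / (|z.im| * y) < 1 := by
    rw [← div_div, div_lt_one hypos]
    exact hy1
  rw [h1] at h2
  have h5 : x = 0 := by
    by_contra hne
    have hpos := norm_pos_iff.mpr hne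
    nlinarith
  have hu := hQ.isUnit_pencil_conj hD hζ.1 (hQ.mem_holDomain_iff.mp hζ).2
  exact negInverse_injective hu (h5.trans (map_zero _).symm)

/-- The functions `-(D + Q(z) - z)⁻¹` belong to the class `N¹_κ(R)`, where `κ` is the dimension of
the space. -/
theorem isN1R_negInverse (hQ : IsQFunction Q G C) (hD : IsSelfAdjoint D) :
    IsN1R (Module.finrank ℂ N) (negInverse D Q) where
  isNR :=
    { isN := hQ.isN_negInverse hD
      tendsto_div := fun f => by
        have h1 := (tendsto_const_nhds (x := f)).inner (𝕜 := ℂ)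
          (hQ.tendsto_negInverse_apply (D := D) f)
        have h2 := (Complex.continuous_ofReal.tendsto 0).comp tendsto_inv_atTop_zero
        simpa [div_eq_mul_inv, Function.comp_def] using h1.mul h2
      kernel_trivial := fun _ hz => hQ.ker_kernelN_negInverse hD hz
      tendsto_zero := fun f _ => hQ.tendsto_negInverse_apply f }
  setB_eq := hQ.setB_negInverse

end IsQFunction

end KreinLanger

end

noncomputable section

namespace KreinLanger

/-! ### Resolvents of self-adjoint operators -/

section SelfAdjoint

variable {H : Type*} [NormedAddCommGroup H] [InnerProductSpace ℂ H] [CompleteSpace H]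
  {A : H →ₗ.[ℂ] H}

theorem norm_resolvent_mul_le (hA : IsSelfAdjoint A) {z : ℂ} (hz : z.im ≠ 0) :
    ‖resolvent A z‖ * |z.im| ≤ 1 := by
  rw [← le_div_iff₀ (abs_pos.mpr hz)]
  refine ContinuousLinearMap.opNorm_le_bound _ (by positivity) fun y => ?_
  obtain ⟨x, hx, hxy⟩ := (isResolventAt_resolvent hA hz).2 y
  have h := norm_le_of_isSelfAdjoint hA z x
  rw [hxy, hx] at h
  rw [one_div_mul_eq_div, le_div_iff₀ (abs_pos.mpr hz)]
  linarith

theorem adjoint_resolvent (hA : IsSelfAdjoint A) {z : ℂ} (hz : z.im ≠ 0) :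
    ContinuousLinearMap.adjoint (resolvent A z) = resolvent A (starRingEnd ℂ z) := by
  have hzc : (starRingEnd ℂ z).im ≠ 0 := by simpa using hz
  have hf : A.IsFormalAdjoint A := by
    have h := LinearPMap.adjoint_isFormalAdjoint hA.dense_domain
    rwa [LinearPMap.isSelfAdjoint_def.mp hA] at h
  symm
  rw [ContinuousLinearMap.eq_adjoint_iff]
  intro u v
  obtain ⟨x, hx, hxu⟩ := (isResolventAt_resolvent hA hzc).2 u
  obtain ⟨y, hy, hyv⟩ := (isResolventAt_resolvent hA hz).2 v
  rw [← hx, ← hy, ← hxu, ← hyv, inner_sub_left, inner_sub_right, inner_smul_left,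
    inner_smul_right, Complex.conj_conj, hf x y]

theorem resolvent_sub_resolvent (hA : IsSelfAdjoint A) {z a : ℂ} (hz : z.im ≠ 0)
    (ha : a.im ≠ 0) :
    resolvent A z - resolvent A a = (z - a) • (resolvent A z).comp (resolvent A a) := by
  ext y
  obtain ⟨x, hx, hxy⟩ := (isResolventAt_resolvent hA ha).2 y
  have h := (isResolventAt_resolvent hA hz).1 x
  have h1 : A x - z • (x : H) = y - (z - a) • (x : H) := by
    rw [← hxy, sub_smul]
    abel
  rw [h1, map_sub, map_smul] at h
  simp only [sub_apply, smul_apply, ContinuousLinearMap.comp_apply]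
  rw [← hx, sub_eq_iff_eq_add]
  nth_rewrite 2 [← h]
  abel

variable {N : Type*} [NormedAddCommGroup N] [InnerProductSpace ℂ N] [CompleteSpace N]

/-- `B (A - z)⁻¹ B^*` is a `Q`-function. -/
theorem isQFunction_resolvent (hA : IsSelfAdjoint A) (B : H →L[ℂ] N) :
    IsQFunction (fun z => (B.comp (resolvent A z)).comp (ContinuousLinearMap.adjoint B))
      (fun z => (resolvent A z).comp (ContinuousLinearMap.adjoint B)) (‖B‖ * ‖B‖) where
  adjoint_eq z hz := by
    simp only [ContinuousLinearMap.adjoint_comp, ContinuousLinearMap.adjoint_adjoint,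
      adjoint_resolvent hA hz, ContinuousLinearMap.comp_assoc]
  sub_eq z a hz ha := by
    have hzc : (starRingEnd ℂ z).im ≠ 0 := by simpa using hz
    rw [ContinuousLinearMap.adjoint_comp, ContinuousLinearMap.adjoint_adjoint,
      adjoint_resolvent hA hzc, Complex.conj_conj, ← ContinuousLinearMap.sub_comp,
      ← ContinuousLinearMap.comp_sub, resolvent_sub_resolvent hA hz ha]
    simp only [ContinuousLinearMap.comp_smul, ContinuousLinearMap.smul_comp,
      ContinuousLinearMap.comp_assoc]
  norm_le z hz := by
    have h1 : ‖(B.comp (resolvent A z)).comp (ContinuousLinearMap.adjoint B)‖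
        ≤ ‖B‖ * ‖resolvent A z‖ * ‖B‖ := by
      refine (ContinuousLinearMap.opNorm_comp_le _ _).trans ?_
      rw [LinearIsometryEquiv.norm_map]
      gcongr
      exact ContinuousLinearMap.opNorm_comp_le _ _
    calc _ ≤ ‖B‖ * ‖resolvent A z‖ * ‖B‖ * |z.im| := by gcongr
      _ = ‖B‖ * ‖B‖ * (‖resolvent A z‖ * |z.im|) := by ring
      _ ≤ ‖B‖ * ‖B‖ * 1 := by gcongr; exact norm_resolvent_mul_le hA hz
      _ = ‖B‖ * ‖B‖ := mul_one _

end SelfAdjoint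

/-! ### Stieltjes transforms as `Q`-functions -/

section StieltjesTransform

open MeasureTheory

theorem abs_im_le_norm_ofReal_sub (t : ℝ) (z : ℂ) : |z.im| ≤ ‖(t : ℂ) - z‖ := by
  simpa using Complex.abs_im_le_norm ((t : ℂ) - z)

theorem ofReal_sub_ne_zero {z : ℂ} (hz : z.im ≠ 0) (t : ℝ) : (t : ℂ) - z ≠ 0 :=
  norm_pos_iff.mp ((abs_pos.mpr hz).trans_le (abs_im_le_norm_ofReal_sub t z))

variable (μ : Measure ℝ) (r : ℝ → ℝ)

/-- The Stieltjes transform of the measure with density `r ^ 2` with respect to `μ`. -/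
def stieltjes (z : ℂ) : ℂ := ∫ t, ((r t ^ 2 : ℝ) : ℂ) / ((t : ℂ) - z) ∂μ

open Classical in
/-- The function `t ↦ r(t) / (t - z)` as an element of `L²(μ)`. -/
def cauchyVector (z : ℂ) : Lp ℂ 2 μ :=
  if h : MemLp (fun t : ℝ => (r t : ℂ) / ((t : ℂ) - z)) 2 μ then h.toLp _ else 0

variable {μ r} [IsFiniteMeasure μ] {K : ℝ}

theorem coeFn_cauchyVector (hr : Measurable r) (hK : ∀ t, |r t| ≤ K) {z : ℂ} (hz : z.im ≠ 0) :
    cauchyVector μ r z =ᵐ[μ] fun t : ℝ => (r t : ℂ) / ((t : ℂ) - z) := by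
  have h : MemLp (fun t : ℝ => (r t : ℂ) / ((t : ℂ) - z)) 2 μ := by
    refine MemLp.of_bound (Measurable.aestronglyMeasurable (by fun_prop)) (K / |z.im|)
      (Eventually.of_forall fun t => ?_)
    rw [norm_div, Complex.norm_real, Real.norm_eq_abs]
    have := (abs_nonneg (r t)).trans (hK t)
    exact div_le_div₀ this (hK t) (abs_pos.mpr hz) (abs_im_le_norm_ofReal_sub t z)
  rw [cauchyVector, dif_pos h]
  exact h.coeFn_toLp

theorem norm_stieltjes_integrand_le (hK : ∀ t, |r t| ≤ K) {z : ℂ} (hz : z.im ≠ 0) (t : ℝ) :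
    ‖((r t ^ 2 : ℝ) : ℂ) / ((t : ℂ) - z)‖ ≤ K ^ 2 / |z.im| := by
  rw [norm_div, Complex.norm_real, Real.norm_of_nonneg (sq_nonneg _)]
  exact div_le_div₀ (sq_nonneg K) (sq_le_sq' (by linarith [abs_le.mp (hK t)])
    (abs_le.mp (hK t)).2) (abs_pos.mpr hz) (abs_im_le_norm_ofReal_sub t z)

theorem integrable_stieltjes (hr : Measurable r) (hK : ∀ t, |r t| ≤ K) {z : ℂ}
    (hz : z.im ≠ 0) : Integrable (fun t : ℝ => ((r t ^ 2 : ℝ) : ℂ) / ((t : ℂ) - z)) μ :=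
  Integrable.of_bound (Measurable.aestronglyMeasurable (by fun_prop)) (K ^ 2 / |z.im|)
    (Eventually.of_forall fun t => norm_stieltjes_integrand_le hK hz t)

/-- The Stieltjes transform of a finite measure is a `Q`-function. -/
theorem isQFunction_stieltjes (hr : Measurable r) (hK : ∀ t, |r t| ≤ K) :
    IsQFunction (fun z => stieltjes μ r z • ContinuousLinearMap.id ℂ ℂ)
      (fun z => ContinuousLinearMap.toSpanSingleton ℂ (cauchyVector μ r z))
      (K ^ 2 * μ.real Set.univ) where
  adjoint_eq z hz := by
    rw [map_smulₛₗ, ContinuousLinearMap.adjoint_id]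
    congr 1
    rw [stieltjes, ← integral_conj]
    simp [stieltjes]
  sub_eq z a hz ha := by
    have hzc : (starRingEnd ℂ z).im ≠ 0 := by simpa using hz
    -- Partial fractions: the inner product is `∫ r² / ((t - z)(t - a)) dμ`.
    have h : stieltjes μ r z - stieltjes μ r a
        = (z - a) * inner ℂ (cauchyVector μ r (starRingEnd ℂ z)) (cauchyVector μ r a) := by
      rw [stieltjes, stieltjes,
        ← integral_sub (integrable_stieltjes hr hK hz) (integrable_stieltjes hr hK ha),
        L2.inner_def, ← integral_const_mul]
      refine integral_congr_ae ?_
      filter_upwards [coeFn_cauchyVector (μ := μ) hr hK hzc, coeFn_cauchyVector (μ := μ) hr hK ha]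
        with t h1 h2
      rw [h1, h2]
      have h3 := ofReal_sub_ne_zero hz t
      have h4 := ofReal_sub_ne_zero ha t
      simp only [RCLike.inner_apply, map_div₀, map_sub, Complex.conj_ofReal, Complex.conj_conj]
      field_simp
      push_cast
      ring
    ext
    rw [← sub_smul, h]
    simp only [smul_apply, ContinuousLinearMap.comp_apply, ContinuousLinearMap.id_apply,
      ContinuousLinearMap.toSpanSingleton_apply, one_smul, smul_eq_mul, mul_one]
    congr 1
    have h5 := ContinuousLinearMap.adjoint_inner_right (𝕜 := ℂ)
      (ContinuousLinearMap.toSpanSingleton ℂ (cauchyVector μ r (starRingEnd ℂ z))) (1 : ℂ)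
      (cauchyVector μ r a)
    rw [ContinuousLinearMap.toSpanSingleton_apply, one_smul] at h5
    rw [← h5]
    simp
  norm_le z hz := by
    have h : ‖stieltjes μ r z‖ ≤ K ^ 2 / |z.im| * μ.real Set.univ :=
      norm_integral_le_of_norm_le_const
        (Eventually.of_forall fun t => norm_stieltjes_integrand_le hK hz t)
    rw [norm_smul, ContinuousLinearMap.norm_id, mul_one]
    calc _ ≤ K ^ 2 / |z.im| * μ.real Set.univ * |z.im| := by gcongr
      _ = K ^ 2 * μ.real Set.univ := by
        have := abs_pos.mpr hz
        field_simp

end StieltjesTransform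

/-! ### The scalar semicircle function -/

section Semicircle

open MeasureTheory

theorem ringInverse_smul_id (c : ℂ) :
    Ring.inverse (c • ContinuousLinearMap.id ℂ ℂ) = c⁻¹ • ContinuousLinearMap.id ℂ ℂ := by
  rcases eq_or_ne c 0 with rfl | hc
  · have h : (0 : ℂ) • ContinuousLinearMap.id ℂ ℂ = 0 := by
      ext
      simp
    rw [inv_zero, h, Ring.inverse_zero]
  · have h1 : (c • ContinuousLinearMap.id ℂ ℂ) * (c⁻¹ • ContinuousLinearMap.id ℂ ℂ) = 1 := by
      ext
      simp [hc]
    have h2 : (c⁻¹ • ContinuousLinearMap.id ℂ ℂ) * (c • ContinuousLinearMap.id ℂ ℂ) = 1 := by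
      ext
      simp [hc]
    exact Ring.inverse_unit ⟨_, _, h1, h2⟩

/-- The square root of the semicircle weight, scaled by `c`. -/
def sqrtWeight (c t : ℝ) : ℝ := c * √(2 / Real.pi * √(1 - t ^ 2))

theorem sqrtWeight_sq (c t : ℝ) : sqrtWeight c t ^ 2 = c ^ 2 * (2 / Real.pi * √(1 - t ^ 2)) := by
  rw [sqrtWeight, mul_pow, Real.sq_sqrt (by positivity)]

theorem abs_sqrtWeight_le (c t : ℝ) : |sqrtWeight c t| ≤ |c| * √(2 / Real.pi) := by
  rw [sqrtWeight, abs_mul, abs_of_nonneg (Real.sqrt_nonneg _)]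
  have h : √(1 - t ^ 2) ≤ 1 := Real.sqrt_le_one.mpr (by nlinarith [sq_nonneg t])
  gcongr
  exact mul_le_of_le_one_right (by positivity) h

theorem measurable_sqrtWeight (c : ℝ) : Measurable (sqrtWeight c) := by
  unfold sqrtWeight
  fun_prop

/-- The factor `|γ|²` is absorbed into the density. The identity includes the poles, where both
inverses are `0`. -/
theorem semicircleFunction_smul_id (d : ℝ) (γ : ℂ) :
    (fun z : ℂ => semicircleFunction d γ z • ContinuousLinearMap.id ℂ ℂ) =
      negInverse ((d : ℂ) • ContinuousLinearMap.id ℂ ℂ) fun z =>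
        stieltjes (volume.restrict (Set.Ioc (-1) 1)) (sqrtWeight ‖γ‖) z •
          ContinuousLinearMap.id ℂ ℂ := by
  funext z
  rw [negInverse, pencil, ← add_smul, ← sub_smul, ringInverse_smul_id, ← neg_smul,
    semicircleFunction, stieltjes, intervalIntegral.integral_of_le (by norm_num),
    ← integral_const_mul]
  congr 6
  funext t
  rw [sqrtWeight_sq, mul_div_assoc', ← Complex.ofReal_mul]

theorem isN1R_semicircleFunction (d : ℝ) (γ : ℂ) :
    IsN1R 1 (fun z : ℂ => semicircleFunction d γ z • ContinuousLinearMap.id ℂ ℂ) := by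
  rw [semicircleFunction_smul_id, ← Module.finrank_self ℂ]
  refine (isQFunction_stieltjes (measurable_sqrtWeight _)
    (abs_sqrtWeight_le _)).isN1R_negInverse ?_
  rw [ContinuousLinearMap.isSelfAdjoint_iff', map_smulₛₗ, ContinuousLinearMap.adjoint_id,
    Complex.conj_ofReal]

end Semicircle

/-! ### Evaluation of the semicircle integral -/

section SemicircleIntegral

open MeasureTheory intervalIntegral

theorem one_sub_mul_exp_ne_zero {u : ℂ} (hu : ‖u‖ < 1) (θ : ℝ) :
    1 - u * Complex.exp (θ * Complex.I) ≠ 0 := by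
  intro h
  have h1 := congrArg norm (sub_eq_zero.mp h)
  rw [norm_mul, Complex.norm_exp_ofReal_mul_I, mul_one, norm_one] at h1
  exact hu.ne h1.symm

/-- The mean value property for `(ζ² - 1) / (1 - u ζ)`. -/
theorem integral_mean_value {u : ℂ} (hu : ‖u‖ < 1) :
    ∫ θ in (0 : ℝ)..2 * Real.pi, (Complex.exp (θ * Complex.I) ^ 2 - 1) /
      (1 - u * Complex.exp (θ * Complex.I)) = (-(2 * Real.pi) : ℂ) := by
  have hd : DiffContOnCl ℂ (fun ζ : ℂ => (ζ ^ 2 - 1) / (1 - u * ζ)) (Metric.ball 0 |1|) := by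
    refine DifferentiableOn.diffContOnCl fun ζ hζ => ?_
    rw [abs_one, closure_ball _ one_ne_zero, mem_closedBall_zero_iff] at hζ
    refine DifferentiableAt.differentiableWithinAt (DifferentiableAt.fun_div (by fun_prop)
      (by fun_prop) fun h => ?_)
    have h1 := congrArg norm (sub_eq_zero.mp h)
    rw [norm_mul, norm_one] at h1
    nlinarith [norm_nonneg u]
  have h := hd.circleAverage
  rw [Real.circleAverage_def, Complex.real_smul] at h
  simp only [circleMap, zero_add, Complex.ofReal_one, one_mul] at h
  have hpi : (2 * (Real.pi : ℂ)) ≠ 0 := by simp [Real.pi_ne_zero]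
  push_cast at h
  rw [inv_mul_eq_iff_eq_mul₀ hpi] at h
  rw [h]
  simp

/-- The semicircle integral in the angular variable, for the Joukowski parameter `u`. -/
theorem integral_sin_sq_div {u : ℂ} (hu : ‖u‖ < 1) :
    ∫ θ in (0 : ℝ)..Real.pi, (Real.sin θ : ℂ) ^ 2 / (1 + u ^ 2 - 2 * u * Real.cos θ)
      = (Real.pi / 2 : ℂ) := by
  let F : ℝ → ℂ := fun θ => (Complex.exp (θ * Complex.I) ^ 2 - 1) /
    (1 - u * Complex.exp (θ * Complex.I))
  have hF : Continuous F :=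
    Continuous.div (by fun_prop) (by fun_prop) (one_sub_mul_exp_ne_zero hu)
  have hper : Function.Periodic F (2 * Real.pi) := by
    intro θ
    have : Complex.exp (((θ + 2 * Real.pi : ℝ) : ℂ) * Complex.I) = Complex.exp (θ * Complex.I) := by
      rw [← Complex.exp_periodic (θ * Complex.I)]
      congr 1
      push_cast
      ring
    simp only [F, this]
  -- With `p = e^{iθ}` and `q = p⁻¹`, the denominator is `(1 - up)(1 - uq)`, `sin² θ = -(p - q)² /
  -- 4`, and the numerators of `F θ + F (-θ)` combine to `(p - q)²`.
  have hsum : ∀ θ : ℝ, (Real.sin θ : ℂ) ^ 2 / (1 + u ^ 2 - 2 * u * Real.cos θ)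
      = -(1 / 4) * (F θ + F (-θ)) := by
    intro θ
    have h1 := one_sub_mul_exp_ne_zero hu θ
    have h2 := one_sub_mul_exp_ne_zero hu (-θ)
    have hs : (Real.sin θ : ℂ) = (Complex.exp (((-θ : ℝ) : ℂ) * Complex.I)
        - Complex.exp (θ * Complex.I)) * Complex.I / 2 := by
      rw [Complex.ofReal_sin, Complex.sin]
      push_cast
      ring
    have hc : (Real.cos θ : ℂ) = (Complex.exp (θ * Complex.I)
        + Complex.exp (((-θ : ℝ) : ℂ) * Complex.I)) / 2 := by
      rw [Complex.ofReal_cos, Complex.cos]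
      push_cast
      ring
    have hmul : Complex.exp (θ * Complex.I) * Complex.exp (((-θ : ℝ) : ℂ) * Complex.I) = 1 := by
      rw [← Complex.exp_add]
      push_cast
      ring_nf
      exact Complex.exp_zero
    simp only [F]
    rw [hs, hc]
    set p := Complex.exp (θ * Complex.I)
    set q := Complex.exp (((-θ : ℝ) : ℂ) * Complex.I)
    have hden : 1 + u ^ 2 - 2 * u * ((p + q) / 2) = (1 - u * p) * (1 - u * q) := by
      linear_combination -u ^ 2 * hmul
    rw [hden, div_add_div _ _ h1 h2, ← mul_div_assoc]
    congr 1
    linear_combination ((q - p) ^ 2 / 4) * Complex.I_sq + (1 / 2 - u * (p + q) / 4) * hmul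
  have hint : ∀ a b, IntervalIntegrable F volume a b := fun a b => hF.intervalIntegrable a b
  calc _ = ∫ θ in (0 : ℝ)..Real.pi, -(1 / 4) * (F θ + F (-θ)) :=
        integral_congr fun θ _ => hsum θ
    _ = -(1 / 4) * ((∫ θ in (0 : ℝ)..Real.pi, F θ) + ∫ θ in (-Real.pi)..0, F θ) := by
        have hneg : IntervalIntegrable (fun θ => F (-θ)) volume 0 Real.pi :=
          (hF.comp continuous_neg).intervalIntegrable _ _
        rw [intervalIntegral.integral_const_mul, intervalIntegral.integral_add (hint _ _) hneg,
          integral_comp_neg, neg_zero]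
    _ = -(1 / 4) * ∫ θ in (-Real.pi)..(-Real.pi + 2 * Real.pi), F θ := by
        rw [add_comm, integral_add_adjacent_intervals (hint _ _) (hint _ _)]
        congr 3
        ring
    _ = -(1 / 4) * ∫ θ in (0 : ℝ)..(0 + 2 * Real.pi), F θ := by
        rw [hper.intervalIntegral_add_eq (-Real.pi) 0]
    _ = Real.pi / 2 := by
        rw [zero_add]
        simp only [F]
        rw [integral_mean_value hu]
        ring

/-- Since `(z - w)(z + w) = 1`, it is enough that `|z - w| < |z + w|`, that is, `Re z Re w + Im z Im
w > 0`. The second product is positive by the choice of branch, and `Re w Im w = Re z Im z` then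
makes the first nonnegative. -/
theorem norm_sub_lt_one_of_sq_eq {z w : ℂ} (hw : w ^ 2 = z ^ 2 - 1) (h : 0 < w.im * z.im) :
    ‖z - w‖ < 1 := by
  have hre : w.re * w.im = z.re * z.im := by
    have := congrArg Complex.im hw
    simp [pow_two] at this
    linarith
  have hpos : 0 ≤ w.re * z.re := by
    by_contra hneg
    have h1 := mul_neg_of_neg_of_pos (not_le.mp hneg) h
    have h2 : w.re * z.re * (w.im * z.im) = (z.re * z.im) ^ 2 := by
      linear_combination (z.re * z.im) * hre
    exact absurd (h2 ▸ sq_nonneg (z.re * z.im)) (not_le.mpr h1)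
  have hmul : ‖z - w‖ * ‖z + w‖ = 1 := by
    rw [← norm_mul, show (z - w) * (z + w) = 1 by linear_combination -hw, norm_one]
  have hlt : ‖z - w‖ ^ 2 < ‖z + w‖ ^ 2 := by
    rw [Complex.sq_norm, Complex.sq_norm, Complex.normSq_apply, Complex.normSq_apply]
    simp only [Complex.sub_re, Complex.sub_im, Complex.add_re, Complex.add_im]
    nlinarith
  nlinarith [norm_nonneg (z - w), norm_nonneg (z + w)]

/-- The Stieltjes transform of the semicircle distribution. -/
theorem integral_sqrt_div_sub {z w : ℂ} (hz : z.im ≠ 0) (hw : w ^ 2 = z ^ 2 - 1)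
    (h : 0 < w.im * z.im) :
    ∫ t in (-1 : ℝ)..1, ((2 / Real.pi * √(1 - t ^ 2) : ℝ) : ℂ) / ((t : ℂ) - z)
      = 2 * (w - z) := by
  have hu := norm_sub_lt_one_of_sq_eq hw h
  have hpi : (Real.pi : ℂ) ≠ 0 := by simp [Real.pi_ne_zero]
  let g : ℝ → ℂ := fun t => ((2 / Real.pi * √(1 - t ^ 2) : ℝ) : ℂ) / ((t : ℂ) - z)
  have hg : Continuous g := Continuous.div (by fun_prop) (by fun_prop) (ofReal_sub_ne_zero hz)
  have hsub := integral_deriv_smul_comp (a := 0) (b := Real.pi) (g := g) (f := Real.cos)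
    (f' := fun θ => -Real.sin θ) (fun θ _ => Real.hasDerivAt_cos θ) (by fun_prop) hg
  rw [Real.cos_zero, Real.cos_pi, integral_symm (-1) 1] at hsub
  have hu0 : z - w ≠ 0 := by
    intro h0
    have h1 : (z - w) * (z + w) = 1 := by linear_combination -hw
    rw [h0, zero_mul] at h1
    exact zero_ne_one h1
  have hcongr : ∫ θ in (0 : ℝ)..Real.pi, (-Real.sin θ) • (g ∘ Real.cos) θ
      = ∫ θ in (0 : ℝ)..Real.pi, (4 * (z - w) / Real.pi) *
        ((Real.sin θ : ℂ) ^ 2 / (1 + (z - w) ^ 2 - 2 * (z - w) * Real.cos θ)) := by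
    refine integral_congr fun θ hθ => ?_
    rw [Set.uIcc_of_le Real.pi_pos.le] at hθ
    have hsin : √(1 - Real.cos θ ^ 2) = Real.sin θ := by
      rw [← Real.abs_sin_eq_sqrt_one_sub_cos_sq, abs_of_nonneg (Real.sin_nonneg_of_mem_Icc hθ)]
    have hne := ofReal_sub_ne_zero hz (Real.cos θ)
    -- The parameter `u = z - w` satisfies `1 + u² = 2uz`.
    have hden : 1 + (z - w) ^ 2 - 2 * (z - w) * Real.cos θ
        = -2 * (z - w) * ((Real.cos θ : ℂ) - z) := by
      linear_combination hw
    simp only [g, Function.comp_apply, hsin, Complex.real_smul]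
    rw [hden]
    push_cast
    field_simp
    ring
  rw [hcongr, intervalIntegral.integral_const_mul, integral_sin_sq_div hu] at hsub
  calc ∫ t in (-1 : ℝ)..1, g t = -(4 * (z - w) / Real.pi * (Real.pi / 2)) := by
        rw [hsub, neg_neg]
    _ = 2 * (w - z) := by
      field_simp
      ring

theorem semicircleFunction_eq {d : ℝ} {γ z w : ℂ} (hz : z.im ≠ 0) (hw : w ^ 2 = z ^ 2 - 1)
    (h : 0 < w.im * z.im) : semicircleFunction d γ z =
      1 / ((1 + 2 * ((‖γ‖ ^ 2 : ℝ) : ℂ)) * z - 2 * ((‖γ‖ ^ 2 : ℝ) : ℂ) * w - (d : ℂ)) := by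
  rw [semicircleFunction, integral_sqrt_div_sub hz hw h, ← inv_neg, one_div]
  congr 1
  ring

end SemicircleIntegral

end KreinLanger

end

open KreinLanger in
theorem theorem8p1 :
    (∀ (H₀ N : Type*) [NormedAddCommGroup H₀] [InnerProductSpace ℂ H₀] [CompleteSpace H₀]
        [NormedAddCommGroup N] [InnerProductSpace ℂ N] [CompleteSpace N] [FiniteDimensional ℂ N]
        (κ : ℕ) (_ : Module.finrank ℂ N = κ)
        (A₀ : H₀ →ₗ.[ℂ] H₀) (_ : IsSelfAdjoint A₀)
        (B : H₀ →L[ℂ] N) (D : N →L[ℂ] N) (_ : IsSelfAdjoint D),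
        IsN1R κ (schurFunction A₀ B D)) ∧
    (∀ (d : ℝ) (γ : ℂ), γ ≠ 0 →
        IsN1R 1 (fun z : ℂ => semicircleFunction d γ z • ContinuousLinearMap.id ℂ ℂ) ∧
        ∀ z w : ℂ, z.im ≠ 0 → w ^ 2 = z ^ 2 - 1 → 0 < w.im * z.im →
          semicircleFunction d γ z =
            1 / ((1 + 2 * ((‖γ‖ ^ 2 : ℝ) : ℂ)) * z - 2 * ((‖γ‖ ^ 2 : ℝ) : ℂ) * w - (d : ℂ))) := by
  refine ⟨?_, fun d γ _ => ⟨isN1R_semicircleFunction d γ, fun z w => semicircleFunction_eq⟩⟩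
  rintro H₀ N _ _ _ _ _ _ _ κ rfl A₀ hA B D hD
  exact (isQFunction_resolvent hA B).isN1R_negInverse hD
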